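/- Let $(M,g)$ be a smooth vacuum spacetime (signature $(+,-,-,-)$, $\mathrm{Ric}=0$) with spinor structure given by a global orthonormal tetrad, and let $S\subset M$ be a smoothly embedded spacelike hypersurface with unit normal $N^a$, $N_aN^a=1$. Spinor indices are moved by $\xi^A=\epsilon^{AB}\xi_B$, $\xi_B=\xi^A\epsilon_{AB}$. Let $\Psi_{ABCD}=\Psi_{(ABCD)}$ be the Weyl spinor, $\mathcal P=N^{AA'}\nabla_{AA'}$ the normal derivative, $\mathcal D_{AB}=\sqrt2\,N_{(A}{}^{A'}\nabla_{B)A'}$ the Sen derivative on $S$, and $$\mathcal H_{ABCDEF}=\Psi_{PQR(A}\Psi^{QR}{}_{BC}\Psi^{P}{}_{DEF)},\qquad \dot{\mathcal H}_{ABCDEF}=\mathcal P\,\mathcal H_{ABCDEF}.$$ Let $U\subset S$ be open and suppose that the curvature is of Petrov type D on $U$, with smooth Petrov-adapted spin dyad $\{o,\iota\}$; that is, on $U$ one has $o_A\iota^A=1$ and $\Psi_{ABCD}=\Psi\, o_{(A}o_B\iota_C\iota_{D)}$ for a nowhere vanishing function $\Psi:U\to\mathbb C$. Put $$\gamma_{\mathbf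 1\mathbf 1}{}^{\mathbf 0}{}_{\mathbf 1}=\iota^A\iota^B\iota^C\mathcal D_{AB}\iota_C,\qquad \gamma_{\mathbf 0\mathbf 0}{}^{\mathbf 1}{}_{\mathbf 0}=-o^Ao^Bo^C\mathcal D_{AB}o_C .$$ Then, on $U$, $$\dot{\mathcal H}_{ABCDEF}=-\frac{\sqrt2}{8}\,\Psi^3\left(\gamma_{\mathbf 1\mathbf 1}{}^{\mathbf 0}{}_{\mathbf 1}\,o_{(A}o_Bo_Co_Do_E\iota_{F)}+\gamma_{\mathbf 0\mathbf 0}{}^{\mathbf 1}{}_{\mathbf 0}\,o_{(A}\iota_B\iota_C\iota_D\iota_E\iota_{F)}\right).$$ Hence, at each point of $U$, $\dot{\mathcal H}_{ABCDEF}=0$ if and only if $\gamma_{\mathbf 1\mathbf 1}{}^{\mathbf 0}{}_{\mathbf 1}=\gamma_{\mathbf 0\mathbf 0}{}^{\mathbf 1}{}_{\mathbf 0}=0$. -/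

import Mathlib

open scoped Manifold ContDiff

noncomputable section

namespace SpaceSpinor

/-! ## Spinor algebra

All spinor indices are lower indices and refer to a spin frame `ε_0, ε_1` with
`ε_{01} = ε^{01} = 1`; indices are moved by `ξ^A = ε^{AB} ξ_B`. -/

/-- Components of a covariant spinor of valence `n`. -/
abbrev Spinor (n : ℕ) := (Fin n → Fin 2) → ℂ

/-- The components `ε_{AB}`, which are also those of `ε^{AB}`. -/
def eps : Matrix (Fin 2) (Fin 2) ℂ := !![0, 1; -1, 0]

/-- Raising of an index: `ξ^A = ε^{AB} ξ_B`. -/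
def raise (ξ : Fin 2 → ℂ) : Fin 2 → ℂ := fun A => ∑ B, eps A B * ξ B

/-- Total symmetrisation `T_{(A₁ … Aₙ)}`. -/
def symmetrize {n : ℕ} (T : Spinor n) : Spinor n := fun A =>
  (n.factorial : ℂ)⁻¹ * ∑ π : Equiv.Perm (Fin n), T (A ∘ π)

/-- The symmetrised product `v₀_{(A₁} v₁_{A₂} ⋯ _{Aₙ)}` of spinors of valence one. -/
def symProd {n : ℕ} (v : Fin n → Fin 2 → ℂ) : Spinor n :=
  symmetrize fun A => ∏ k, v k (A k)

/-- The spinor `H_{ABCDEF} = Ψ_{PQR(A} Ψ^{QR}_{BC} Ψ^P_{DEF)}`. -/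
def cubicConcomitant (Ψ : Spinor 4) : Spinor 6 :=
  symmetrize fun A =>
    ∑ P, ∑ Q, ∑ R, ∑ P', ∑ Q', ∑ R', eps P P' * eps Q Q' * eps R R' *
      (Ψ ![P, Q, R, A 0] * Ψ ![Q', R', A 1, A 2] * Ψ ![P', A 3, A 4, A 5])

/-- The Minkowski metric `diag(1, -1, -1, -1)` (diagonal entries). -/
def eta (a : Fin 4) : ℝ := if a = 0 then 1 else -1

/-- The Infeld–van der Waerden symbols `σ^a_{AA'}`: `1/√2` times the identity and the Pauli
matrices. The null tetrad `ε_A ε̄_{A'}` of the spin frame is `∑ a, σ^a_{AA'} e_a`. -/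
def ivdw (a : Fin 4) : Matrix (Fin 2) (Fin 2) ℂ :=
  ((Real.sqrt 2 : ℝ) : ℂ)⁻¹ •
    (![!![1, 0; 0, 1], !![0, 1; 1, 0], !![0, -Complex.I; Complex.I, 0], !![1, 0; 0, -1]] a)

/-! ## Spacetimes -/

/-- A smooth Lorentzian metric of signature `(+,-,-,-)` on a smooth 4-manifold. -/
structure LorentzMetric (M : Type*) [TopologicalSpace M]
    [ChartedSpace (EuclideanSpace ℝ (Fin 4)) M] [IsManifold (𝓡 4) ∞ M] where
  inner (x : M) : TangentSpace (𝓡 4) x →L[ℝ] TangentSpace (𝓡 4) x →L[ℝ] ℝ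
  symm (x : M) (v w : TangentSpace (𝓡 4) x) : inner x v w = inner x w v
  signature (x : M) : ∃ b : Module.Basis (Fin 4) ℝ (TangentSpace (𝓡 4) x),
    ∀ a c, inner x (b a) (b c) = if a = c then eta a else 0
  contMDiff : ContMDiff (𝓡 4)
    ((𝓡 4).prod 𝓘(ℝ, EuclideanSpace ℝ (Fin 4) →L[ℝ] EuclideanSpace ℝ (Fin 4) →L[ℝ] ℝ)) ∞
    (fun x => Bundle.TotalSpace.mk'
      (EuclideanSpace ℝ (Fin 4) →L[ℝ] EuclideanSpace ℝ (Fin 4) →L[ℝ] ℝ) x (inner x))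

/-- A smooth orthonormal tetrad, equivalently (up to an overall sign) a smooth spin frame: it
trivialises the spinor bundle, so that spinor fields become component functions. -/
structure Tetrad {M : Type*} [TopologicalSpace M]
    [ChartedSpace (EuclideanSpace ℝ (Fin 4)) M] [IsManifold (𝓡 4) ∞ M]
    (g : LorentzMetric M) where
  vec (a : Fin 4) (x : M) : TangentSpace (𝓡 4) x
  contMDiff (a : Fin 4) : ContMDiff (𝓡 4) (𝓡 4).tangent ∞
    (fun x => (⟨x, vec a x⟩ : TangentBundle (𝓡 4) M))
  orthonormal (x : M) (a c : Fin 4) :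
    g.inner x (vec a x) (vec c x) = if a = c then eta a else 0

namespace Tetrad

variable {M : Type*} [TopologicalSpace M]
  [ChartedSpace (EuclideanSpace ℝ (Fin 4)) M] [IsManifold (𝓡 4) ∞ M]
  {g : LorentzMetric M} (e : Tetrad g)

/-- `g([e_a, e_b], e_c)`. -/
def bracket (a b c : Fin 4) (x : M) : ℝ :=
  g.inner x (VectorField.mlieBracket (𝓡 4) (e.vec a) (e.vec b) x) (e.vec c x)

/-- The Levi-Civita connection in the tetrad: `ω_{abc} = g(∇_{e_a} e_b, e_c)`, given by the Koszul
formula (the derivatives of the constants `g(e_a, e_b)` drop out). -/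
def omega (a b c : Fin 4) (x : M) : ℝ :=
  (e.bracket a b c x - e.bracket b c a x + e.bracket c a b x) / 2

/-- The Riemann tensor in the tetrad, `R_{abcd} = g(R(e_a, e_b) e_c, e_d)` with
`R(X, Y) = ∇_X ∇_Y - ∇_Y ∇_X - ∇_{[X, Y]}`. -/
def riemann (a b c d : Fin 4) (x : M) : ℝ :=
  mvfderiv (𝓡 4) (e.omega b c d) x (e.vec a x) - mvfderiv (𝓡 4) (e.omega a c d) x (e.vec b x)
    + ∑ f, eta f * (e.omega b c f x * e.omega a f d x - e.omega a c f x * e.omega b f d x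
        - e.bracket a b f x * e.omega f c d x)

/-- The vacuum Einstein equations `R_{ac} = R_{abc}{}^b = 0`. -/
def IsVacuum : Prop := ∀ (x : M) (a c : Fin 4), ∑ b, eta b * e.riemann a b c b x = 0

/-- The Weyl spinor `Ψ_{ABCD} = X_{(ABCD)}`, where
`X_{ABCD} = ¼ ε^{A'B'} ε^{C'D'} R_{AA'BB'CC'DD'}`. -/
def weylSpinor (x : M) : Spinor 4 :=
  symmetrize fun A =>
    4⁻¹ * ∑ a, ∑ b, ∑ c, ∑ d, ∑ i, ∑ j, ∑ k, ∑ l,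
      eps i j * eps k l *
        (ivdw a (A 0) i * ivdw b (A 1) j * ivdw c (A 2) k * ivdw d (A 3) l) *
        (e.riemann a b c d x : ℂ)

/-- The spin connection `Γ_{aB}{}^C`, defined by `∇_{e_a} ε_B = Γ_{aB}{}^C ε_C`: one has
`Γ_{aBC} = ½ ε^{B'C'} ω_{a BB' CC'}` and `Γ_{aB}{}^C = ε^{CD} Γ_{aBD}`. -/
def spinConnection (a : Fin 4) (B C : Fin 2) (x : M) : ℂ :=
  ∑ D, eps C D * (2⁻¹ * ∑ i, ∑ j, ∑ b, ∑ c,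
    eps i j * ivdw b B i * ivdw c D j * (e.omega a b c x : ℂ))

/-- The spin connection along a tangent vector. -/
def spinConnectionAlong (x : M) (v : TangentSpace (𝓡 4) x) (B C : Fin 2) : ℂ :=
  ∑ a, ((eta a * g.inner x v (e.vec a x) : ℝ) : ℂ) * e.spinConnection a B C x

/-- The spinor covariant derivative `∇_v T` of a spinor field of valence `n` at `x`. -/
def covDeriv {n : ℕ} (T : M → Spinor n) (x : M) (v : TangentSpace (𝓡 4) x) : Spinor n :=
  fun A => mvfderiv (𝓡 4) (fun y => T y A) x v
    - ∑ k, ∑ C, e.spinConnectionAlong x v (A k) C * T x (Function.update A k C)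

/-- The field `H_{ABCDEF}` built from the Weyl spinor. -/
def weylCubic (x : M) : Spinor 6 := cubicConcomitant (e.weylSpinor x)

end Tetrad

/-! ## Spacelike hypersurfaces -/

/-- A smoothly embedded hypersurface `S` in a spacetime with a smooth unit normal `N`,
`g(N, N) = 1`; such a hypersurface is spacelike. -/
structure SpacelikeHypersurface (S : Type*) [TopologicalSpace S]
    [ChartedSpace (EuclideanSpace ℝ (Fin 3)) S] [IsManifold (𝓡 3) ∞ S]
    {M : Type*} [TopologicalSpace M] [ChartedSpace (EuclideanSpace ℝ (Fin 4)) M]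
    [IsManifold (𝓡 4) ∞ M] (g : LorentzMetric M) where
  toFun : S → M
  contMDiff : ContMDiff (𝓡 3) (𝓡 4) ∞ toFun
  isEmbedding : Topology.IsEmbedding toFun
  injective_mfderiv (s : S) : Function.Injective (mfderiv (𝓡 3) (𝓡 4) toFun s)
  normal (s : S) : TangentSpace (𝓡 4) (toFun s)
  contMDiff_normal : ContMDiff (𝓡 3) (𝓡 4).tangent ∞
    (fun s => (⟨toFun s, normal s⟩ : TangentBundle (𝓡 4) M))
  normal_unit (s : S) : g.inner (toFun s) (normal s) (normal s) = 1
  normal_orthogonal (s : S) (u : TangentSpace (𝓡 3) s) :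
    g.inner (toFun s) (normal s) (mfderiv (𝓡 3) (𝓡 4) toFun s u) = 0

namespace SpacelikeHypersurface

variable {S : Type*} [TopologicalSpace S]
  [ChartedSpace (EuclideanSpace ℝ (Fin 3)) S] [IsManifold (𝓡 3) ∞ S]
  {M : Type*} [TopologicalSpace M] [ChartedSpace (EuclideanSpace ℝ (Fin 4)) M]
  [IsManifold (𝓡 4) ∞ M] {g : LorentzMetric M} (𝒮 : SpacelikeHypersurface S g) (e : Tetrad g)

/-- The tangential part `v - g(v, N) N` of a spacetime vector at a point of the hypersurface, as a
vector tangent to `S` (see `mfderiv_tangential`). -/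
def tangential (s : S) (v : TangentSpace (𝓡 4) (𝒮.toFun s)) : TangentSpace (𝓡 3) s :=
  Function.invFun (mfderiv (𝓡 3) (𝓡 4) 𝒮.toFun s)
    (v - g.inner (𝒮.toFun s) v (𝒮.normal s) • 𝒮.normal s)

theorem mfderiv_tangential (s : S) (v : TangentSpace (𝓡 4) (𝒮.toFun s)) :
    mfderiv (𝓡 3) (𝓡 4) 𝒮.toFun s (𝒮.tangential s v) =
      v - g.inner (𝒮.toFun s) v (𝒮.normal s) • 𝒮.normal s := by
  set L := (mfderiv (𝓡 3) (𝓡 4) 𝒮.toFun s).toLinearMap with hL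
  set φ := (g.inner (𝒮.toFun s) (𝒮.normal s)).toLinearMap with hφ
  have hd3 : Module.finrank ℝ (TangentSpace (𝓡 3) s) = 3 :=
    finrank_euclideanSpace_fin (𝕜 := ℝ) (n := 3)
  have hd4 : Module.finrank ℝ (TangentSpace (𝓡 4) (𝒮.toFun s)) = 4 :=
    finrank_euclideanSpace_fin (𝕜 := ℝ) (n := 4)
  have : FiniteDimensional ℝ (TangentSpace (𝓡 3) s) := Module.finite_of_finrank_eq_succ hd3
  have : FiniteDimensional ℝ (TangentSpace (𝓡 4) (𝒮.toFun s)) :=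
    Module.finite_of_finrank_eq_succ hd4
  have hle : LinearMap.range L ≤ LinearMap.ker φ := by
    rintro _ ⟨u, rfl⟩
    exact 𝒮.normal_orthogonal s u
  have hr : Module.finrank ℝ (LinearMap.range L) = 3 := by
    rw [LinearMap.finrank_range_of_inj (𝒮.injective_mfderiv s), hd3]
  have hsurj : LinearMap.range φ = ⊤ := by
    rw [LinearMap.range_eq_top]
    intro c
    exact ⟨c • 𝒮.normal s, by
      rw [map_smul]
      change c * g.inner (𝒮.toFun s) (𝒮.normal s) (𝒮.normal s) = c
      rw [𝒮.normal_unit, mul_one]⟩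
  have hk : Module.finrank ℝ (LinearMap.ker φ) = 3 := by
    have h := LinearMap.finrank_range_add_finrank_ker φ
    rw [hsurj, finrank_top, Module.finrank_self, hd4] at h
    omega
  have heq := Submodule.eq_of_le_of_finrank_eq hle (hr.trans hk.symm)
  have hmem : v - g.inner (𝒮.toFun s) v (𝒮.normal s) • 𝒮.normal s ∈ LinearMap.range L := by
    rw [heq, LinearMap.mem_ker, map_sub, map_smul]
    change g.inner (𝒮.toFun s) (𝒮.normal s) v
      - g.inner (𝒮.toFun s) v (𝒮.normal s) * g.inner (𝒮.toFun s) (𝒮.normal s) (𝒮.normal s) = 0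
    rw [𝒮.normal_unit, g.symm, mul_one, sub_self]
  exact Function.invFun_eq hmem

/-- `N_{AA'} = σ^a_{AA'} N_a` with `N_a = g(N, e_a)`. -/
def normalSpinor (s : S) (A i : Fin 2) : ℂ :=
  ∑ a, (g.inner (𝒮.toFun s) (𝒮.normal s) (e.vec a (𝒮.toFun s)) : ℂ) * ivdw a A i

/-- `N_A{}^{A'} = ε^{A'B'} N_{AB'}`. -/
def normalSpinorMixed (s : S) (A i : Fin 2) : ℂ := ∑ j, eps i j * 𝒮.normalSpinor e s A j

/-- The covariant derivative along a tangent vector of `S` of a valence-one spinor field `ξ_C`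
defined on `S`. -/
def covDerivAlong (ξ : S → Fin 2 → ℂ) (s : S) (u : TangentSpace (𝓡 3) s) (C : Fin 2) : ℂ :=
  mvfderiv (𝓡 3) (fun r => ξ r C) s u
    - ∑ D, e.spinConnectionAlong (𝒮.toFun s) (mfderiv (𝓡 3) (𝓡 4) 𝒮.toFun s u) C D * ξ s D

/-- The Sen derivative `𝒟_{AB} ξ_C = √2 N_{(A}{}^{A'} ∇_{B)A'} ξ_C`, where
`∇_{BA'} = ∑ b, σ^b_{BA'} ∇_{e_b}`. The normal parts of the `e_b` cancel in this sum, so that only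
derivatives tangent to `S` occur. -/
def sen (ξ : S → Fin 2 → ℂ) (s : S) (A B C : Fin 2) : ℂ :=
  (Real.sqrt 2 : ℂ) * ∑ b, ∑ i,
    2⁻¹ * (𝒮.normalSpinorMixed e s A i * ivdw b B i + 𝒮.normalSpinorMixed e s B i * ivdw b A i) *
      𝒮.covDerivAlong e ξ s (𝒮.tangential s (e.vec b (𝒮.toFun s))) C

/-- The spin coefficients `γ_{ab}{}^c{}_d = -ε_d{}^Q ε_a{}^A ε_b{}^B 𝒟_{AB} ε^c{}_Q` of the
Sen connection in the dyad `o, ι`, where `ε_0{}^A = o^A`, `ε_1{}^A = ι^A`, `ε^0{}_A = -ι_A`,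
`ε^1{}_A = o_A`. -/
def spinCoeff (o ι : S → Fin 2 → ℂ) (a b c d : Fin 2) (s : S) : ℂ :=
  -∑ Q, ∑ A, ∑ B,
    raise (![o s, ι s] d) Q * raise (![o s, ι s] a) A * raise (![o s, ι s] b) B *
      𝒮.sen e (![fun r => -ι r, o] c) s A B Q

/-- The curvature is of Petrov type D on `U ⊆ S`, with Petrov-adapted spin dyad `o, ι`:
`o_A ι^A = 1` and `Ψ_{ABCD} = ψ o_{(A} o_B ι_C ι_{D)}` with `ψ` nowhere zero. -/
structure IsPetrovAdapted (U : Set S) (o ι : S → Fin 2 → ℂ) (ψ : S → ℂ) : Prop where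
  contMDiffOn_o : ContMDiffOn (𝓡 3) 𝓘(ℝ, Fin 2 → ℂ) ∞ o U
  contMDiffOn_iota : ContMDiffOn (𝓡 3) 𝓘(ℝ, Fin 2 → ℂ) ∞ ι U
  dyad : ∀ s ∈ U, ∑ A, o s A * raise (ι s) A = 1
  ne_zero : ∀ s ∈ U, ψ s ≠ 0
  weyl_eq : ∀ s ∈ U, ∀ A, e.weylSpinor (𝒮.toFun s) A = ψ s * symProd ![o s, o s, ι s, ι s] A

/-- `Ḣ_{ABCDEF} = 𝒫 H_{ABCDEF}` on `S`, with `𝒫 = N^{AA'} ∇_{AA'}` the covariant derivative along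
the unit normal. -/
def cubicDot (s : S) : Spinor 6 := e.covDeriv e.weylCubic (𝒮.toFun s) (𝒮.normal s)

end SpacelikeHypersurface

end SpaceSpinor

end

open SpaceSpinor

/-!
Let `Ψ` be the Weyl spinor. By the Leibniz rule `𝒫H` is linear in `𝒫Ψ`, and since the connection
is `𝔰𝔩(2)`-valued and `H` is a covariant of `Ψ`, it is the algebraic variation of the cubic
covariant in the direction `𝒫Ψ` (`covComp_sexticComp`, `Tetrad.covDeriv_weylCubic`). At a spinor
of type D, `Ψ = ψ o_{(A} o_B ι_C ι_{D)}`, all components of the variation but two drop out,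
because the corresponding directions are tangent to the set of type D spinors, on which `H`
vanishes: only `𝒫Ψ(ι,ι,ι,ι)` and `𝒫Ψ(o,o,o,o)` survive, with the
coefficients `¼ ψ² o⁵ι` and `-¼ ψ² oι⁵` (`sexticVar_typeD`).

These two components are computed from the vacuum Bianchi identity `∇^{A}_{A'} Ψ_{ABCD} = 0`. Let
`ξ` be one of the two repeated principal spinors. Along `S` one has `Ψ_{ABCD} ξ^B ξ^C ξ^D = 0`,
whose tangential derivatives give `ξ^B ξ^C ξ^D ∇_u Ψ_{ABCD} = ½ ψ ξ_A ξ^C ∇_u ξ_C`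
(`SpacelikeHypersurface.IsPetrovAdapted.cubicContract_tangent`). Splitting `∇_{AA'}` in the Bianchi
identity into its tangential and normal parts and contracting it with `ξ^B ξ^C ξ^D` and with
`N_E{}^{A'} ξ^E` then expresses `𝒫Ψ(ξ,ξ,ξ,ξ)` as `-(ψ/√2) ξ^A ξ^B ξ^C 𝒟_{AB} ξ_C`
(`SpacelikeHypersurface.IsPetrovAdapted.binaryForm_normal`), where `ξ^A ξ^B ξ^C 𝒟_{AB} ξ_C` is, up to
sign, one of the two spin coefficients of the Sen connection.

The Bianchi identity has to be derived from the definition of the curvature through the structure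
functions of the tetrad. The Jacobi identity for the tetrad, and for `e_a, e_b, f e_0`, gives the
two Bianchi identities of the Riemann tensor (`Tetrad.riemann_cyclic`,
`Tetrad.covRiemann_cyclic`). In vacuum the Riemann tensor and its covariant derivative have the
symmetries of a Weyl tensor, and the passage to spinors is made through their self-dual parts: a
Weyl tensor becomes a symmetric trace-free complex `3 × 3` matrix, which amounts to a totally
symmetric spinor of valence four (`IsWeylTensor.sum_ivdw`), the spin connection becomes the self-dual
part of the Levi-Civita connection acting by the cross product, and the divergence of the
curvature becomes that of `Ψ` (`Tetrad.covDeriv_weylSpinor_vec`, `Tetrad.weyl_bianchi_comp`).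

Totally symmetric spinors are handled through their components, indexed by the number of indices
equal to `1` (`ofComp`), and through their binary forms (`binaryForm`), which determine them.
-/

noncomputable section

set_option linter.unusedSectionVars false

namespace SpaceSpinor

/-! ### Calculus in an orthonormal tetrad -/

theorem eta_zero : eta 0 = 1 := rfl
theorem eta_one : eta 1 = -1 := rfl
theorem eta_two : eta 2 = -1 := rfl
theorem eta_three : eta 3 = -1 := rfl

namespace Tetrad

variable {M : Type*} [TopologicalSpace M]
  [ChartedSpace (EuclideanSpace ℝ (Fin 4)) M] [IsManifold (𝓡 4) ∞ M]
  {g : LorentzMetric M} (e : Tetrad g)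

open VectorField

theorem two_le_infty : (2 : WithTop ℕ∞) ≤ ∞ := by
  have : ((2 : ℕ∞) : WithTop ℕ∞) ≤ ((⊤ : ℕ∞) : WithTop ℕ∞) := WithTop.coe_le_coe.mpr le_top
  exact this

theorem three_le_infty : (3 : WithTop ℕ∞) ≤ ∞ := by
  have : ((3 : ℕ∞) : WithTop ℕ∞) ≤ ((⊤ : ℕ∞) : WithTop ℕ∞) := WithTop.coe_le_coe.mpr le_top
  exact this

instance : IsManifold (𝓡 4) (minSmoothness ℝ 2) M := by
  rw [minSmoothness_of_isRCLikeNormedField]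
  exact IsManifold.of_le two_le_infty

instance : IsManifold (𝓡 4) (minSmoothness ℝ 3) M := by
  rw [minSmoothness_of_isRCLikeNormedField]
  exact IsManifold.of_le three_le_infty

/-- Smoothness of a vector field on spacetime. -/
def SmoothField (V : ∀ x : M, TangentSpace (𝓡 4) x) : Prop :=
  ContMDiff (𝓡 4) (𝓡 4).tangent ∞ (fun x => (⟨x, V x⟩ : TangentBundle (𝓡 4) M))

/-- Smoothness of a real function on spacetime. -/
def SmoothFun (f : M → ℝ) : Prop := ContMDiff (𝓡 4) 𝓘(ℝ, ℝ) ∞ f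

theorem SmoothField.contMDiffAt_two {V : ∀ x : M, TangentSpace (𝓡 4) x} (hV : SmoothField V)
    (x : M) : ContMDiffAt (𝓡 4) (𝓡 4).tangent (minSmoothness ℝ 2)
      (fun x => (⟨x, V x⟩ : TangentBundle (𝓡 4) M)) x := by
  rw [minSmoothness_of_isRCLikeNormedField]
  exact (hV x).of_le two_le_infty

theorem SmoothField.mdiff {V : ∀ x : M, TangentSpace (𝓡 4) x} (hV : SmoothField V) (x : M) :
    MDifferentiableAt (𝓡 4) (𝓡 4).tangent (fun x => (⟨x, V x⟩ : TangentBundle (𝓡 4) M)) x :=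
  (hV x).mdifferentiableAt (by simp)

theorem SmoothFun.mdiff {f : M → ℝ} (hf : SmoothFun f) (x : M) :
    MDifferentiableAt (𝓡 4) 𝓘(ℝ, ℝ) f x :=
  (hf x).mdifferentiableAt (by simp)

theorem SmoothField.mlieBracket {V W : ∀ x : M, TangentSpace (𝓡 4) x} (hV : SmoothField V)
    (hW : SmoothField W) : SmoothField (mlieBracket (𝓡 4) V W) := by
  have : IsManifold (𝓡 4) (((⊤ : ℕ∞) : WithTop ℕ∞) + 1) M := by
    simpa using (inferInstance : IsManifold (𝓡 4) ∞ M)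
  intro x
  refine ContMDiffAt.mlieBracket_vectorField (m := ⊤) (n := ⊤) (hV x) (hW x) ?_
  simp

theorem SmoothField.inner {V W : ∀ x : M, TangentSpace (𝓡 4) x} (hV : SmoothField V)
    (hW : SmoothField W) : SmoothFun (fun x => g.inner x (V x) (W x)) := by
  intro x
  have : ContMDiffAt (𝓡 4) ((𝓡 4).prod 𝓘(ℝ)) ∞
      (fun m ↦ Bundle.TotalSpace.mk' ℝ (E := Bundle.Trivial M ℝ) m (g.inner m (V m) (W m))) x := by
    apply ContMDiffAt.clm_bundle_apply₂ (F₁ := EuclideanSpace ℝ (Fin 4))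
      (F₂ := EuclideanSpace ℝ (Fin 4))
    · exact g.contMDiff x
    · exact hV x
    · exact hW x
  rw [Bundle.contMDiffAt_totalSpace] at this
  exact this.2

theorem SmoothField.smul {f : M → ℝ} {V : ∀ x : M, TangentSpace (𝓡 4) x} (hf : SmoothFun f)
    (hV : SmoothField V) : SmoothField (f • V) :=
  fun x => (hf x).smul_section (hV x)

theorem SmoothField.add {V W : ∀ x : M, TangentSpace (𝓡 4) x} (hV : SmoothField V)
    (hW : SmoothField W) : SmoothField (V + W) :=
  fun x => (hV x).add_section (hW x)

theorem eta_mul_self (a : Fin 4) : eta a * eta a = 1 := by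
  unfold eta; split_ifs <;> norm_num

theorem eta_ne_zero (a : Fin 4) : eta a ≠ 0 := by
  unfold eta; split_ifs <;> norm_num

/-- Expansion of a vector in the tetrad. -/
theorem sum_eta_inner_smul_vec (x : M) (v : TangentSpace (𝓡 4) x) :
    ∑ a, (eta a * g.inner x v (e.vec a x)) • e.vec a x = v := by
  have hd4 : Module.finrank ℝ (TangentSpace (𝓡 4) x) = 4 :=
    finrank_euclideanSpace_fin (𝕜 := ℝ) (n := 4)
  have : FiniteDimensional ℝ (TangentSpace (𝓡 4) x) :=
    Module.finite_of_finrank_eq_succ hd4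
  have key : ∀ (c : Fin 4 → ℝ) (d : Fin 4),
      g.inner x (∑ a, c a • e.vec a x) (e.vec d x) = c d * eta d := by
    intro c d
    simp [map_sum, e.orthonormal]
  have hli : LinearIndependent ℝ (fun a => e.vec a x) := by
    rw [Fintype.linearIndependent_iff]
    intro c hc d
    have := key c d
    rw [hc] at this
    simp only [map_zero, zero_apply] at this
    exact (mul_eq_zero.mp this.symm).resolve_right (eta_ne_zero d)
  have hspan : Submodule.span ℝ (Set.range (fun a => e.vec a x)) = ⊤ :=
    hli.span_eq_top_of_card_eq_finrank' (by rw [hd4]; rfl)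
  have hv : v ∈ Submodule.span ℝ (Set.range (fun a => e.vec a x)) := hspan ▸ Submodule.mem_top
  obtain ⟨c, rfl⟩ := (Submodule.mem_span_range_iff_exists_fun ℝ).mp hv
  refine Finset.sum_congr rfl fun a _ => ?_
  rw [key, mul_comm (c a), ← mul_assoc, eta_mul_self, one_mul]

theorem smoothField_vec (a : Fin 4) : SmoothField (e.vec a) := e.contMDiff a

/-- The derivative of a function along the tetrad vector `e_a`. -/
def frameDeriv {F : Type*} [NormedAddCommGroup F] [NormedSpace ℝ F] (a : Fin 4) (f : M → F)
    (x : M) : F := mvfderiv (𝓡 4) f x (e.vec a x)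

theorem bracket_antisymm (a b c : Fin 4) (x : M) : e.bracket a b c x = -e.bracket b a c x := by
  unfold bracket
  rw [mlieBracket_swap_apply]; simp

theorem smooth_bracket (a b c : Fin 4) : SmoothFun (e.bracket a b c) :=
  ((e.smoothField_vec a).mlieBracket (e.smoothField_vec b)).inner (e.smoothField_vec c)

theorem mlieBracket_vec_smul (a : Fin 4) {f : M → ℝ} (hf : SmoothFun f)
    {V : ∀ x : M, TangentSpace (𝓡 4) x} (hV : SmoothField V) :
    mlieBracket (𝓡 4) (e.vec a) (f • V) =
      e.frameDeriv a f • V + f • mlieBracket (𝓡 4) (e.vec a) V := by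
  ext1 x
  exact mlieBracket_smul_right (hf.mdiff x) (hV.mdiff x)

theorem SmoothFun.add {f h : M → ℝ} (hf : SmoothFun f) (hh : SmoothFun h) :
    SmoothFun (fun x => f x + h x) := ContMDiff.add hf hh

theorem SmoothFun.sub {f h : M → ℝ} (hf : SmoothFun f) (hh : SmoothFun h) :
    SmoothFun (fun x => f x - h x) := ContMDiff.sub hf hh

theorem SmoothFun.mul {f h : M → ℝ} (hf : SmoothFun f) (hh : SmoothFun h) :
    SmoothFun (fun x => f x * h x) := ContMDiff.mul hf hh

theorem SmoothFun.const (c : ℝ) : SmoothFun (fun _ : M => c) := contMDiff_const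

theorem SmoothFun.sum {ι : Type*} (s : Finset ι) {f : ι → M → ℝ}
    (hf : ∀ i ∈ s, SmoothFun (f i)) : SmoothFun (fun x => ∑ i ∈ s, f i x) :=
  contMDiff_finsetSum hf

/-- The derivative of a smooth function along `e_a` is smooth: it is a component of
`[e_a, f e_0] - f [e_a, e_0]`. -/
theorem SmoothFun.frameDeriv (a : Fin 4) {f : M → ℝ} (hf : SmoothFun f) :
    SmoothFun (e.frameDeriv a f) := by
  have h : SmoothFun (fun x => eta 0 * (
      g.inner x (VectorField.mlieBracket (𝓡 4) (e.vec a) (f • e.vec 0) x) (e.vec 0 x)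
        - f x * e.bracket a 0 0 x)) :=
    (SmoothFun.const _).mul <|
      (((e.smoothField_vec a).mlieBracket ((e.smoothField_vec 0).smul hf)).inner
        (e.smoothField_vec 0)).sub (hf.mul (e.smooth_bracket a 0 0))
  convert h using 2 with x
  rw [e.mlieBracket_vec_smul a hf (e.smoothField_vec 0)]
  simp [bracket, e.orthonormal, eta]

/-- The components of `[e_a, V]`. -/
theorem inner_mlieBracket_vec (a d : Fin 4) {V : ∀ x : M, TangentSpace (𝓡 4) x}
    (hV : SmoothField V) (x : M) :
    g.inner x (VectorField.mlieBracket (𝓡 4) (e.vec a) V x) (e.vec d x) =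
      e.frameDeriv a (fun y => g.inner y (V y) (e.vec d y)) x +
        ∑ f, eta f * g.inner x (V x) (e.vec f x) * e.bracket a f d x := by
  have hc : ∀ f, SmoothFun (fun y => eta f * g.inner y (V y) (e.vec f y)) := fun f =>
    (SmoothFun.const _).mul (hV.inner (e.smoothField_vec f))
  -- Expand `V` in the tetrad and apply the Leibniz rule to each term.
  set W : Fin 4 → ∀ x : M, TangentSpace (𝓡 4) x := fun f =>
    (fun y => eta f * g.inner y (V y) (e.vec f y)) • e.vec f with hW
  have hWs : ∀ f, SmoothField (W f) := fun f => (e.smoothField_vec f).smul (hc f)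
  have hVW : V = W 0 + W 1 + W 2 + W 3 := by
    ext1 y
    have := e.sum_eta_inner_smul_vec y (V y)
    rw [Fin.sum_univ_four] at this
    exact this.symm
  have hb : ∀ f, g.inner x (VectorField.mlieBracket (𝓡 4) (e.vec a) (W f) x) (e.vec d x) =
      (if f = d then e.frameDeriv a (fun y => g.inner y (V y) (e.vec f y)) x else 0) +
        eta f * g.inner x (V x) (e.vec f x) * e.bracket a f d x := by
    intro f
    rw [hW]
    dsimp only
    rw [e.mlieBracket_vec_smul a (hc f) (e.smoothField_vec f)]
    have : e.frameDeriv a (fun y => eta f * g.inner y (V y) (e.vec f y)) x =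
        eta f * e.frameDeriv a (fun y => g.inner y (V y) (e.vec f y)) x := by
      unfold frameDeriv
      have h1 := mvfderiv_fun_mul ((SmoothFun.const (M := M) (eta f)).mdiff x)
        ((hV.inner (g := g) (e.smoothField_vec f)).mdiff x)
      rw [h1, mvfderiv_const]
      simp
    simp only [Pi.add_apply, Pi.smul_apply', map_add, map_smul, add_apply, smul_apply,
      smul_eq_mul, e.orthonormal, this, bracket]
    split_ifs with h
    · rw [mul_right_comm, eta_mul_self, one_mul]
    · ring
  conv_lhs => rw [hVW]
  rw [mlieBracket_add_right (((hWs 0).add (hWs 1)).add (hWs 2) |>.mdiff x) ((hWs 3).mdiff x),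
    mlieBracket_add_right (((hWs 0).add (hWs 1)).mdiff x) ((hWs 2).mdiff x),
    mlieBracket_add_right ((hWs 0).mdiff x) ((hWs 1).mdiff x)]
  simp only [map_add, add_apply, hb, Fin.sum_univ_four]
  fin_cases d <;> simp <;> ring

/-- The Leibniz form of the Jacobi identity for `e_a`, `e_b` and a vector field. -/
theorem leibniz_vec (a b : Fin 4) {V : ∀ x : M, TangentSpace (𝓡 4) x} (hV : SmoothField V)
    (x : M) :
    VectorField.mlieBracket (𝓡 4) (e.vec a) (VectorField.mlieBracket (𝓡 4) (e.vec b) V) x =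
      VectorField.mlieBracket (𝓡 4) (VectorField.mlieBracket (𝓡 4) (e.vec a) (e.vec b)) V x +
      VectorField.mlieBracket (𝓡 4) (e.vec b) (VectorField.mlieBracket (𝓡 4) (e.vec a) V) x :=
  leibniz_identity_mlieBracket_apply ((e.smoothField_vec a).contMDiffAt_two x)
    ((e.smoothField_vec b).contMDiffAt_two x) (hV.contMDiffAt_two x)

/-- The Jacobi identity in terms of the structure functions of the tetrad. -/
theorem jacobi_bracket (a b c d : Fin 4) (x : M) :
    e.frameDeriv a (e.bracket b c d) x + e.frameDeriv b (e.bracket c a d) x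
      + e.frameDeriv c (e.bracket a b d) x
      + ∑ f, eta f * (e.bracket b c f x * e.bracket a f d x + e.bracket c a f x * e.bracket b f d x
        + e.bracket a b f x * e.bracket c f d x) = 0 := by
  have hs := fun p q => (e.smoothField_vec p).mlieBracket (e.smoothField_vec q)
  have h := congrArg (fun v => g.inner x v (e.vec d x)) (e.leibniz_vec a b (e.smoothField_vec c) x)
  have hsw : VectorField.mlieBracket (𝓡 4) (VectorField.mlieBracket (𝓡 4) (e.vec a) (e.vec b))
      (e.vec c) x = - VectorField.mlieBracket (𝓡 4) (e.vec c)
        (VectorField.mlieBracket (𝓡 4) (e.vec a) (e.vec b)) x := mlieBracket_swap_apply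
  simp only [map_add, add_apply, hsw, map_neg, neg_apply, e.inner_mlieBracket_vec _ _ (hs _ _)] at h
  change e.frameDeriv a (e.bracket b c d) x + ∑ f, eta f * e.bracket b c f x * e.bracket a f d x =
    -(e.frameDeriv c (e.bracket a b d) x + ∑ f, eta f * e.bracket a b f x * e.bracket c f d x) +
    (e.frameDeriv b (e.bracket a c d) x + ∑ f, eta f * e.bracket a c f x * e.bracket b f d x) at h
  have hn : e.bracket c a d = -e.bracket a c d := by
    ext1 y; exact e.bracket_antisymm c a d y
  have hn' : e.frameDeriv b (e.bracket c a d) x = - e.frameDeriv b (e.bracket a c d) x := by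
    rw [hn]; unfold frameDeriv; rw [mvfderiv_neg]; rfl
  simp only [hn', e.bracket_antisymm c a, mul_add, Finset.sum_add_distrib, neg_mul, mul_neg,
    Finset.sum_neg_distrib, ← mul_assoc]
  linear_combination h

/-- The bracket of two tetrad vectors acts on functions as the commutator of derivatives. It is
obtained from the Jacobi identity for `e_a`, `e_b` and `f e_0`. -/
theorem frameDeriv_comm (a b : Fin 4) {f : M → ℝ} (hf : SmoothFun f) (x : M) :
    e.frameDeriv a (e.frameDeriv b f) x - e.frameDeriv b (e.frameDeriv a f) x =
      ∑ c, eta c * e.bracket a b c x * e.frameDeriv c f x := by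
  have h0 := e.smoothField_vec 0
  have h := e.leibniz_vec a b (h0.smul hf) x
  have key : ∀ p q, VectorField.mlieBracket (𝓡 4) (e.vec p)
      (VectorField.mlieBracket (𝓡 4) (e.vec q) (f • e.vec 0)) x =
      e.frameDeriv p (e.frameDeriv q f) x • e.vec 0 x
        + e.frameDeriv q f x • VectorField.mlieBracket (𝓡 4) (e.vec p) (e.vec 0) x
        + (e.frameDeriv p f x • VectorField.mlieBracket (𝓡 4) (e.vec q) (e.vec 0) x
        + f x • VectorField.mlieBracket (𝓡 4) (e.vec p)
            (VectorField.mlieBracket (𝓡 4) (e.vec q) (e.vec 0)) x) := by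
    intro p q
    have hq := (e.smoothField_vec q).mlieBracket h0
    rw [e.mlieBracket_vec_smul q hf h0, mlieBracket_add_right
      ((h0.smul (SmoothFun.frameDeriv e q hf)).mdiff x) ((hq.smul hf).mdiff x),
      e.mlieBracket_vec_smul p (SmoothFun.frameDeriv e q hf) h0,
      e.mlieBracket_vec_smul p hf hq]
    rfl
  rw [key, key, mlieBracket_smul_right (hf.mdiff x) (h0.mdiff x), e.leibniz_vec a b h0 x] at h
  -- Only the second derivatives of `f`, along `e_0`, survive in the Leibniz identity.
  have hv : (e.frameDeriv a (e.frameDeriv b f) x - e.frameDeriv b (e.frameDeriv a f) x) • e.vec 0 x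
      = (mvfderiv (𝓡 4) f x (VectorField.mlieBracket (𝓡 4) (e.vec a) (e.vec b) x)) • e.vec 0 x := by
    rw [sub_smul]
    rw [smul_add] at h
    linear_combination (norm := module) h
  have h1 := congrArg (fun v => g.inner x v (e.vec 0 x)) hv
  simp only [map_smul, smul_apply, e.orthonormal, if_true, smul_eq_mul, eta, mul_one] at h1
  rw [h1]
  conv_lhs => rw [← e.sum_eta_inner_smul_vec x (VectorField.mlieBracket _ _ _ x)]
  simp [map_sum, frameDeriv, bracket]

end Tetrad

/-! ### Directional derivatives -/

section DirectionalDerivative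

variable {E : Type*} [NormedAddCommGroup E] [NormedSpace ℝ E] {H : Type*} [TopologicalSpace H]
  {I : ModelWithCorners ℝ E H} {X : Type*} [TopologicalSpace X] [ChartedSpace H X]
  {𝔸 : Type*} [NormedCommRing 𝔸] [NormedAlgebra ℝ 𝔸] {x : X} {v : TangentSpace I x}
  {f h : X → 𝔸} {f' h' : 𝔸}

/-- `f` is differentiable at `x` with derivative `f'` in the direction `v`. -/
def HasDirDeriv (v : TangentSpace I x) (f : X → 𝔸) (f' : 𝔸) : Prop :=
  MDifferentiableAt I 𝓘(ℝ, 𝔸) f x ∧ mvfderiv I f x v = f'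

theorem HasDirDeriv.const (c : 𝔸) : HasDirDeriv v (fun _ => c) 0 :=
  ⟨mdifferentiableAt_const, by rw [mvfderiv_const]; rfl⟩

theorem HasDirDeriv.add (hf : HasDirDeriv v f f') (hh : HasDirDeriv v h h') :
    HasDirDeriv v (fun y => f y + h y) (f' + h') :=
  ⟨hf.1.add hh.1, by rw [mvfderiv_fun_add hf.1 hh.1, add_apply, hf.2, hh.2]⟩

theorem HasDirDeriv.sub (hf : HasDirDeriv v f f') (hh : HasDirDeriv v h h') :
    HasDirDeriv v (fun y => f y - h y) (f' - h') :=
  ⟨hf.1.sub hh.1, by rw [mvfderiv_fun_sub hf.1 hh.1, sub_apply, hf.2, hh.2]⟩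

theorem HasDirDeriv.neg (hf : HasDirDeriv v f f') :
    HasDirDeriv v (fun y => - f y) (- f') :=
  ⟨hf.1.neg, by rw [mvfderiv_fun_neg, neg_apply, hf.2]⟩

theorem HasDirDeriv.mul (hf : HasDirDeriv v f f') (hh : HasDirDeriv v h h') :
    HasDirDeriv v (fun y => f y * h y) (f' * h x + f x * h') := by
  have := hf.1.hasMFDerivAt.mul hh.1.hasMFDerivAt
  refine ⟨this.mdifferentiableAt, ?_⟩
  have h2 : mvfderiv I (fun y => f y * h y) x v =
      f x * mvfderiv I h x v + h x * mvfderiv I f x v := by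
    have := congrArg (fun L => L v) this.mfderiv
    exact this
  rw [h2, hf.2, hh.2]; ring

theorem HasDirDeriv.sum {ι : Type*} (s : Finset ι) {f : ι → X → 𝔸} {f' : ι → 𝔸}
    (hf : ∀ i ∈ s, HasDirDeriv v (f i) (f' i)) :
    HasDirDeriv v (fun y => ∑ i ∈ s, f i y) (∑ i ∈ s, f' i) := by
  classical
  induction s using Finset.induction_on with
  | empty => simpa using HasDirDeriv.const (v := v) (0 : 𝔸)
  | insert i s hi ih =>
    simp only [Finset.sum_insert hi]
    exact (hf i (Finset.mem_insert_self i s)).add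
      (ih fun j hj => hf j (Finset.mem_insert_of_mem hj))

end DirectionalDerivative

/-! ### The Riemann tensor and its Bianchi identities -/

namespace Tetrad

variable {M : Type*} [TopologicalSpace M]
  [ChartedSpace (EuclideanSpace ℝ (Fin 4)) M] [IsManifold (𝓡 4) ∞ M]
  {g : LorentzMetric M} (e : Tetrad g)

theorem SmoothFun.hasDirDeriv {f : M → ℝ} (hf : SmoothFun f) (a : Fin 4) (x : M) :
    HasDirDeriv (I := 𝓡 4) (e.vec a x) f (e.frameDeriv a f x) := ⟨hf.mdiff x, rfl⟩

theorem smooth_omega (a b c : Fin 4) : SmoothFun (e.omega a b c) := by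
  unfold omega
  simp only [div_eq_mul_inv]
  exact (((e.smooth_bracket a b c).sub (e.smooth_bracket b c a)).add
    (e.smooth_bracket c a b)).mul (SmoothFun.const _)

theorem omega_antisymm (a b c : Fin 4) (x : M) : e.omega a b c x = -e.omega a c b x := by
  unfold omega
  rw [e.bracket_antisymm a c, e.bracket_antisymm c b, e.bracket_antisymm b a]; ring

/-- The Levi-Civita connection is torsion free. -/
theorem bracket_eq_omega_sub (a b c : Fin 4) (x : M) :
    e.bracket a b c x = e.omega a b c x - e.omega b a c x := by
  unfold omega
  rw [e.bracket_antisymm a c, e.bracket_antisymm c b, e.bracket_antisymm b a]; ring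

theorem frameDeriv_bracket (k a b c : Fin 4) (x : M) :
    e.frameDeriv k (e.bracket a b c) x =
      e.frameDeriv k (e.omega a b c) x - e.frameDeriv k (e.omega b a c) x := by
  have : e.bracket a b c = fun y => e.omega a b c y - e.omega b a c y :=
    funext fun y => e.bracket_eq_omega_sub a b c y
  rw [this]
  exact ((SmoothFun.hasDirDeriv e (e.smooth_omega a b c) k x).sub
    (SmoothFun.hasDirDeriv e (e.smooth_omega b a c) k x)).2

theorem frameDeriv_omega_antisymm (k a b c : Fin 4) (x : M) :
    e.frameDeriv k (e.omega a b c) x = -e.frameDeriv k (e.omega a c b) x := by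
  have : e.omega a b c = fun y => -e.omega a c b y :=
    funext fun y => e.omega_antisymm a b c y
  rw [this]
  exact (SmoothFun.hasDirDeriv e (e.smooth_omega a c b) k x).neg.2

/-- The curvature with the structure functions eliminated in favour of the connection. -/
theorem riemann_eq (a b c d : Fin 4) : e.riemann a b c d = fun x =>
    e.frameDeriv a (e.omega b c d) x - e.frameDeriv b (e.omega a c d) x
    + ∑ f, eta f * (e.omega b c f x * e.omega a f d x - e.omega a c f x * e.omega b f d x
        - (e.omega a b f x - e.omega b a f x) * e.omega f c d x) := by
  ext x
  unfold riemann
  simp only [e.bracket_eq_omega_sub]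
  rfl

theorem smooth_riemann (a b c d : Fin 4) : SmoothFun (e.riemann a b c d) := by
  rw [riemann_eq]
  have h := e.smooth_omega
  exact ((SmoothFun.frameDeriv e a (h b c d)).sub (SmoothFun.frameDeriv e b (h a c d))).add <|
    SmoothFun.sum _ fun f _ => (SmoothFun.const _).mul <|
      (((h b c f).mul (h a f d)).sub ((h a c f).mul (h b f d))).sub
        (((h a b f).sub (h b a f)).mul (h f c d))

theorem frameDeriv_riemann (k a b c d : Fin 4) (x : M) : e.frameDeriv k (e.riemann a b c d) x =
    e.frameDeriv k (e.frameDeriv a (e.omega b c d)) x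
    - e.frameDeriv k (e.frameDeriv b (e.omega a c d)) x
    + ∑ f, eta f * (e.frameDeriv k (e.omega b c f) x * e.omega a f d x
        + e.omega b c f x * e.frameDeriv k (e.omega a f d) x
        - (e.frameDeriv k (e.omega a c f) x * e.omega b f d x
        + e.omega a c f x * e.frameDeriv k (e.omega b f d) x)
        - ((e.frameDeriv k (e.omega a b f) x - e.frameDeriv k (e.omega b a f) x) * e.omega f c d x
        + (e.omega a b f x - e.omega b a f x) * e.frameDeriv k (e.omega f c d) x)) := by
  have h := fun a b c => SmoothFun.hasDirDeriv e (e.smooth_omega a b c) k x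
  have h2 := fun l a b c =>
    SmoothFun.hasDirDeriv e (SmoothFun.frameDeriv e l (e.smooth_omega a b c)) k x
  rw [riemann_eq]
  refine ((((h2 a b c d).sub (h2 b a c d)).add <|
    HasDirDeriv.sum _ fun f _ => (HasDirDeriv.const (eta f)).mul <|
      (((h b c f).mul (h a f d)).sub ((h a c f).mul (h b f d))).sub
        (((h a b f).sub (h b a f)).mul (h f c d))).2).trans ?_
  simp only [zero_mul, zero_add]

theorem riemann_antisymm_left (a b c d : Fin 4) (x : M) :
    e.riemann a b c d x = -e.riemann b a c d x := by
  simp only [riemann_eq, Fin.sum_univ_four]; ring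

theorem riemann_antisymm_right (a b c d : Fin 4) (x : M) :
    e.riemann a b c d x = -e.riemann a b d c x := by
  simp only [riemann_eq]
  rw [e.frameDeriv_omega_antisymm a b c d, e.frameDeriv_omega_antisymm b a c d]
  have : ∀ f, eta f * (e.omega b c f x * e.omega a f d x - e.omega a c f x * e.omega b f d x
        - (e.omega a b f x - e.omega b a f x) * e.omega f c d x) =
      - (eta f * (e.omega b d f x * e.omega a f c x - e.omega a d f x * e.omega b f c x
        - (e.omega a b f x - e.omega b a f x) * e.omega f d c x)) := by
    intro f
    rw [e.omega_antisymm b c f, e.omega_antisymm a f d, e.omega_antisymm a c f,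
      e.omega_antisymm b f d, e.omega_antisymm f c d]
    ring
  simp only [this, Finset.sum_neg_distrib]
  ring

/-- The first Bianchi identity, which is the Jacobi identity for the tetrad. -/
theorem riemann_cyclic (a b c d : Fin 4) (x : M) :
    e.riemann a b c d x + e.riemann b c a d x + e.riemann c a b d x = 0 := by
  have h := e.jacobi_bracket a b c d x
  simp only [e.frameDeriv_bracket, e.bracket_eq_omega_sub, Fin.sum_univ_four] at h
  simp only [riemann_eq, Fin.sum_univ_four]
  linear_combination h

theorem riemann_pair_symm (a b c d : Fin 4) (x : M) :
    e.riemann a b c d x = e.riemann c d a b x := by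
  have h1 := e.riemann_cyclic a b c d x
  have h2 := e.riemann_cyclic b c d a x
  have h3 := e.riemann_cyclic c d a b x
  have h4 := e.riemann_cyclic d a b c x
  have l := fun p q r s => e.riemann_antisymm_left p q r s x
  have r := fun p q r s => e.riemann_antisymm_right p q r s x
  linarith [l c a b d, r b c d a, r c d b a, l d b c a, r b d c a, l d a c b, r a d c b,
    r a c d b, l d a b c, r a b d c]

/-- The covariant derivative `∇_k R_{abcd}` of the Riemann tensor. -/
def covRiemann (k a b c d : Fin 4) (x : M) : ℝ :=
  e.frameDeriv k (e.riemann a b c d) x - ∑ f, eta f *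
    (e.omega k a f x * e.riemann f b c d x + e.omega k b f x * e.riemann a f c d x
      + e.omega k c f x * e.riemann a b f d x + e.omega k d f x * e.riemann a b c f x)

set_option maxHeartbeats 4000000 in
/-- The second Bianchi identity. The second derivatives of the connection enter only through
commutators, which `frameDeriv_comm` reduces to first derivatives; the derivatives of the brackets
are removed by the Jacobi identity. -/
theorem covRiemann_cyclic (k a b c d : Fin 4) (x : M) :
    e.covRiemann k a b c d x + e.covRiemann a b k c d x + e.covRiemann b k a c d x = 0 := by
  have hj := fun f => e.jacobi_bracket k a b f x
  have h1 := e.frameDeriv_comm k a (e.smooth_omega b c d) x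
  have h2 := e.frameDeriv_comm a b (e.smooth_omega k c d) x
  have h3 := e.frameDeriv_comm b k (e.smooth_omega a c d) x
  simp only [e.frameDeriv_bracket, e.bracket_eq_omega_sub, Fin.sum_univ_four] at hj h1 h2 h3
  unfold covRiemann
  simp only [e.frameDeriv_riemann]
  simp only [riemann_eq, Fin.sum_univ_four, e.omega_antisymm _ d]
  simp only [eta_zero, eta_one, eta_two, eta_three] at hj h1 h2 h3 ⊢
  linear_combination h1 + h2 + h3 + (- e.omega 0 c d x) * hj 0 + e.omega 1 c d x * hj 1
    + e.omega 2 c d x * hj 2 + e.omega 3 c d x * hj 3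

end Tetrad

/-! ### Self-dual parts of two-forms and of Weyl tensors -/

/-- The self-dual part of a two-form,
`(F_{01} + i F_{23}, F_{02} + i F_{31}, F_{03} + i F_{12})`. -/
def selfDual (F : Fin 4 → Fin 4 → ℂ) : Fin 3 → ℂ :=
  ![F 0 1 + Complex.I * F 2 3, F 0 2 + Complex.I * F 3 1, F 0 3 + Complex.I * F 1 2]

/-- The spinor `φ_{AB} = ε^{A'B'} F_{AA'BB'}` of a two-form, in terms of its self-dual part (see
`sum_ivdw_twoForm`). -/
def twoFormSpinor (u : Fin 3 → ℂ) : Fin 2 → Fin 2 → ℂ :=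
  ![![u 0 - Complex.I * u 1, -u 2], ![-u 2, -u 0 - Complex.I * u 1]]

theorem ofReal_sqrt_two_inv_sq : (((Real.sqrt 2 : ℝ) : ℂ)⁻¹) ^ 2 = 1 / 2 := by
  rw [inv_pow, ← Complex.ofReal_pow, Real.sq_sqrt (by norm_num)]; norm_num

/-- The self-dual part of a two-form is the spinor `ε^{A'B'} F_{AA'BB'}`. -/
theorem sum_ivdw_twoForm (F : Fin 4 → Fin 4 → ℂ) (hF : ∀ a b, F a b = -F b a) (A B : Fin 2) :
    ∑ a, ∑ b, (∑ i, ∑ j, eps i j * ivdw a A i * ivdw b B j) * F a b =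
      twoFormSpinor (selfDual F) A B := by
  have h2 := ofReal_sqrt_two_inv_sq
  have hd : ∀ a, F a a = 0 := fun a => by linear_combination (1 / 2 : ℂ) * hF a a
  have hI := Complex.I_sq
  unfold twoFormSpinor selfDual eps ivdw
  generalize ((Real.sqrt 2 : ℝ) : ℂ)⁻¹ = r at *
  fin_cases A <;> fin_cases B <;>
    simp [Fin.sum_univ_four, Fin.sum_univ_two, hd, hF 1 0, hF 2 0, hF 3 0, hF 3 2, hF 1 3, hF 2 1]
  · linear_combination (F 0 1 + F 3 1 - Complex.I * F 0 2 + Complex.I * F 2 3) * 2 * h2 + F 3 1 * hI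
  · linear_combination (-F 0 3 - Complex.I * F 1 2) * 2 * h2
  · linear_combination (-F 0 3 - Complex.I * F 1 2) * 2 * h2
  · linear_combination (-F 0 1 + F 3 1 - Complex.I * F 0 2 - Complex.I * F 2 3) * 2 * h2
      + F 3 1 * hI

/-- The infinitesimal action of `w ∈ so(1, 3)` on two-forms. -/
def rot (w : Fin 4 → Fin 4 → ℝ) (F : Fin 4 → Fin 4 → ℂ) (a b : Fin 4) : ℂ :=
  ∑ f, (eta f : ℂ) * (w a f * F f b + w b f * F a f)

/-- The cross product of complex three-vectors. -/
def cross (u v : Fin 3 → ℂ) : Fin 3 → ℂ :=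
  ![u 1 * v 2 - u 2 * v 1, u 2 * v 0 - u 0 * v 2, u 0 * v 1 - u 1 * v 0]

/-- The isomorphism of `so(1, 3)` with `so(3, ℂ)`: on self-dual parts, an infinitesimal Lorentz
transformation acts by a cross product. -/
theorem selfDual_rot (w : Fin 4 → Fin 4 → ℝ) (hw : ∀ a b, w a b = -w b a)
    (F : Fin 4 → Fin 4 → ℂ) (hF : ∀ a b, F a b = -F b a) :
    selfDual (rot w F) = fun i =>
      -Complex.I * cross (selfDual fun a b => (w a b : ℂ)) (selfDual F) i := by
  have hd : ∀ a, F a a = 0 := fun a => by linear_combination (1 / 2 : ℂ) * hF a a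
  have hdw : ∀ a, w a a = 0 := fun a => by linear_combination (1 / 2 : ℝ) * hw a a
  have hI := Complex.I_sq
  ext i
  unfold selfDual rot cross
  fin_cases i <;>
    simp [Fin.sum_univ_four, eta, hd, hdw, hF 1 0, hF 2 0, hF 3 0, hF 3 2, hF 1 3, hF 2 1,
      hw 1 0, hw 2 0, hw 3 0, hw 3 2, hw 1 3, hw 2 1]
  · linear_combination (-(w 1 2 : ℂ) * F 0 2 + w 0 2 * F 1 2 + w 3 1 * F 0 3 - w 0 3 * F 3 1
      + Complex.I * ((w 3 1 : ℂ) * F 1 2 - w 1 2 * F 3 1)) * hI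
  · linear_combination (-(w 2 3 : ℂ) * F 0 3 + w 0 3 * F 2 3 + w 1 2 * F 0 1 - w 0 1 * F 1 2
      + Complex.I * ((w 1 2 : ℂ) * F 2 3 - w 2 3 * F 1 2)) * hI
  · linear_combination (-(w 3 1 : ℂ) * F 0 1 + w 0 1 * F 3 1 + w 2 3 * F 0 2 - w 0 2 * F 2 3
      + Complex.I * ((w 2 3 : ℂ) * F 3 1 - w 3 1 * F 2 3)) * hI

/-- A tensor, given by its components in an orthonormal tetrad, with the algebraic symmetries of
the Weyl tensor. -/
structure IsWeylTensor (T : Fin 4 → Fin 4 → Fin 4 → Fin 4 → ℝ) : Prop where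
  antisymm (a b c d : Fin 4) : T a b c d = -T b a c d
  pair_symm (a b c d : Fin 4) : T a b c d = T c d a b
  cyclic (a b c d : Fin 4) : T a b c d + T b c a d + T c a b d = 0
  trace (a c : Fin 4) : ∑ b, eta b * T a b c b = 0

theorem IsWeylTensor.antisymm_right {T : Fin 4 → Fin 4 → Fin 4 → Fin 4 → ℝ}
    (hT : IsWeylTensor T) (a b c d : Fin 4) : T a b c d = -T a b d c := by
  rw [hT.pair_symm, hT.antisymm, hT.pair_symm d c]

/-- The self-dual part of `T` with respect to both pairs of indices. -/
def weylMatrix (T : Fin 4 → Fin 4 → Fin 4 → Fin 4 → ℝ) (i j : Fin 3) : ℂ :=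
  selfDual (fun a b => selfDual (fun c d => (T a b c d : ℂ)) j) i

/-- The self-dual part of `T` with respect to the first pair of indices. -/
def leftSelfDual (T : Fin 4 → Fin 4 → Fin 4 → Fin 4 → ℝ) (i : Fin 3) (c d : Fin 4) : ℂ :=
  selfDual (fun a b => (T a b c d : ℂ)) i

variable {T : Fin 4 → Fin 4 → Fin 4 → Fin 4 → ℝ}

theorem selfDual_leftSelfDual (i j : Fin 3) :
    selfDual (leftSelfDual T i) j = weylMatrix T i j := by
  unfold weylMatrix leftSelfDual selfDual
  fin_cases i <;> fin_cases j <;> simp <;> ring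

/-- For a Weyl tensor the left dual agrees with the right dual; this is where the vanishing of the
trace enters. -/
theorem IsWeylTensor.leftSelfDual_dual (hT : IsWeylTensor T) (i : Fin 3) :
    leftSelfDual T i 2 3 = -Complex.I * leftSelfDual T i 0 1 ∧
    leftSelfDual T i 3 1 = -Complex.I * leftSelfDual T i 0 2 ∧
    leftSelfDual T i 1 2 = -Complex.I * leftSelfDual T i 0 3 := by
  have l := hT.antisymm
  have r := hT.antisymm_right
  have p := hT.pair_symm
  have ld : ∀ a c d, T a a c d = 0 := fun a c d => by linarith [l a a c d]
  have rd : ∀ a b c, T a b c c = 0 := fun a b c => by linarith [r a b c c]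
  have t := hT.trace
  have c0 := hT.cyclic 0 1 2 3
  simp only [Fin.sum_univ_four, eta, if_true, one_mul, neg_mul, one_ne_zero, Fin.reduceEq,
    if_false] at t
  have t00 := t 0 0
  have t01 := t 0 1
  have t02 := t 0 2
  have t03 := t 0 3
  have t11 := t 1 1
  have t12 := t 1 2
  have t13 := t 1 3
  have t22 := t 2 2
  have t23 := t 2 3
  have t33 := t 3 3
  clear t
  simp only [ld, rd, l 1 0, l 2 0, l 3 0, l 3 2, l 1 3, l 2 1, r _ _ 1 0, r _ _ 2 0, r _ _ 3 0,
    r _ _ 3 2, r _ _ 1 3, r _ _ 2 1] at *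
  unfold leftSelfDual selfDual
  refine ⟨?_, ?_, ?_⟩ <;> fin_cases i <;> apply Complex.ext <;> simp
  all_goals
    linarith [p 2 3 0 1, p 2 3 0 2, p 2 3 0 3, p 3 1 0 1, p 3 1 0 2, p 3 1 0 3, p 1 2 0 1,
        p 1 2 0 2, p 1 2 0 3, p 0 2 0 1, p 0 3 0 1, p 0 3 0 2, p 3 1 2 3, p 1 2 2 3, p 1 2 3 1]

theorem IsWeylTensor.leftSelfDual_antisymm (hT : IsWeylTensor T) (i : Fin 3) (c d : Fin 4) :
    leftSelfDual T i c d = -leftSelfDual T i d c := by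
  unfold leftSelfDual selfDual
  have r := fun a b => hT.antisymm_right a b c d
  fin_cases i <;> simp [r] <;> ring

theorem IsWeylTensor.weylMatrix_symm (hT : IsWeylTensor T) (i j : Fin 3) :
    weylMatrix T i j = weylMatrix T j i := by
  unfold weylMatrix selfDual
  fin_cases i <;> fin_cases j <;> simp [hT.pair_symm 2 3 0, hT.pair_symm 3 1 0, hT.pair_symm 1 2 0,
    hT.pair_symm 0 2 0 1, hT.pair_symm 0 3 0 1, hT.pair_symm 0 3 0 2, hT.pair_symm 3 1 2 3,
    hT.pair_symm 1 2 2 3, hT.pair_symm 1 2 3 1] <;> ring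

/-- In terms of the double self-dual part `W`, the components of a left self-dual Weyl tensor are
`W_{ij} / 2` and `-i W_{ij} / 2`. -/
theorem IsWeylTensor.leftSelfDual_eq (hT : IsWeylTensor T) (i : Fin 3) :
    leftSelfDual T i 0 1 = weylMatrix T i 0 / 2 ∧ leftSelfDual T i 0 2 = weylMatrix T i 1 / 2 ∧
    leftSelfDual T i 0 3 = weylMatrix T i 2 / 2 := by
  obtain ⟨h1, h2, h3⟩ := hT.leftSelfDual_dual i
  have hI := Complex.I_sq
  simp only [← selfDual_leftSelfDual]
  simp only [selfDual, Matrix.cons_val_zero, Matrix.cons_val_one, Matrix.cons_val, h1, h2, h3]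
  refine ⟨?_, ?_, ?_⟩
  · linear_combination (1 / 2 * leftSelfDual T i 0 1) * hI
  · linear_combination (1 / 2 * leftSelfDual T i 0 2) * hI
  · linear_combination (1 / 2 * leftSelfDual T i 0 3) * hI

theorem IsWeylTensor.weylMatrix_trace (hT : IsWeylTensor T) :
    weylMatrix T 0 0 + weylMatrix T 1 1 + weylMatrix T 2 2 = 0 := by
  have h0 := (hT.leftSelfDual_eq 0).1
  have h1 := (hT.leftSelfDual_eq 1).2.1
  have h2 := (hT.leftSelfDual_eq 2).2.2
  have t := hT.trace 0 0
  have c0 := hT.cyclic 0 1 2 3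
  have e1 := hT.antisymm 2 0 1 3
  have e2 := hT.antisymm_right 0 2 1 3
  have p1 := hT.pair_symm 0 1 2 3
  have p2 := hT.pair_symm 0 2 3 1
  have p3 := hT.pair_symm 0 3 1 2
  have l := hT.antisymm 0 0 0 0
  simp only [Fin.sum_univ_four, eta, if_true, one_mul, neg_mul, one_ne_zero, Fin.reduceEq,
    if_false] at t
  have key : leftSelfDual T 0 0 1 + leftSelfDual T 1 0 2 + leftSelfDual T 2 0 3 = 0 := by
    unfold leftSelfDual selfDual
    apply Complex.ext <;> simp <;> linarith
  linear_combination 2 * key - 2 * h0 - 2 * h1 - 2 * h2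

/-- The components of the Weyl spinor, indexed by the number of spinor indices equal to `1`, in
terms of the double self-dual part `W` of the Weyl tensor. -/
def spinorComp (W : Fin 3 → Fin 3 → ℂ) : ℕ → ℂ
  | 0 => (W 0 0 - W 1 1 - 2 * Complex.I * W 0 1) / 4
  | 1 => (-W 0 2 + Complex.I * W 1 2) / 4
  | 2 => W 2 2 / 4
  | 3 => (W 0 2 + Complex.I * W 1 2) / 4
  | 4 => (W 0 0 - W 1 1 + 2 * Complex.I * W 0 1) / 4
  | _ => 0

/-- The totally symmetric spinor with given components, indexed by the number of spinor indices
equal to `1`. -/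
def ofComp {n : ℕ} (q : ℕ → ℂ) : Spinor n := fun A => q (∑ k, (A k : ℕ))

theorem sum_val_le {n : ℕ} (A : Fin n → Fin 2) : ∑ k, (A k : ℕ) ≤ n := by
  calc ∑ k, (A k : ℕ) ≤ ∑ k : Fin n, 1 := Finset.sum_le_sum fun k _ => by omega
    _ = n := by simp

theorem ofComp_comp_perm {n : ℕ} (q : ℕ → ℂ) (A : Fin n → Fin 2) (π : Equiv.Perm (Fin n)) :
    ofComp q (A ∘ π) = ofComp q A := by
  unfold ofComp
  congr 1
  exact Equiv.sum_comp π fun k => (A k : ℕ)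

theorem symmetrize_ofComp {n : ℕ} (q : ℕ → ℂ) :
    symmetrize (ofComp q : Spinor n) = ofComp q := by
  ext A
  simp only [symmetrize, ofComp_comp_perm, Finset.sum_const, Finset.card_univ,
    Fintype.card_perm, Fintype.card_fin, nsmul_eq_mul]
  rw [← mul_assoc, inv_mul_cancel₀ (by exact_mod_cast Nat.factorial_ne_zero n), one_mul]

/-- The spinor `¼ ε^{A'B'} ε^{C'D'} T_{AA'BB'CC'DD'}` of a Weyl tensor is totally symmetric. -/
theorem IsWeylTensor.sum_ivdw (hT : IsWeylTensor T) (A : Fin 4 → Fin 2) :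
    4⁻¹ * ∑ a, ∑ b, ∑ c, ∑ d, ∑ i, ∑ j, ∑ k, ∑ l,
      eps i j * eps k l *
        (ivdw a (A 0) i * ivdw b (A 1) j * ivdw c (A 2) k * ivdw d (A 3) l) *
        (T a b c d : ℂ) = ofComp (spinorComp (weylMatrix T)) A := by
  have hS : ∀ a b c d, ∑ i, ∑ j, ∑ k, ∑ l, eps i j * eps k l *
        (ivdw a (A 0) i * ivdw b (A 1) j * ivdw c (A 2) k * ivdw d (A 3) l) * (T a b c d : ℂ) =
      (∑ i, ∑ j, eps i j * ivdw a (A 0) i * ivdw b (A 1) j) *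
        ((∑ k, ∑ l, eps k l * ivdw c (A 2) k * ivdw d (A 3) l) * (T a b c d : ℂ)) := by
    intro a b c d
    simp only [Fin.sum_univ_two]; ring
  simp only [hS, ← Finset.mul_sum]
  have h1 : ∀ a b, ∑ c, ∑ d, (∑ k, ∑ l, eps k l * ivdw c (A 2) k * ivdw d (A 3) l) *
      (T a b c d : ℂ) = twoFormSpinor (selfDual fun c d => (T a b c d : ℂ)) (A 2) (A 3) :=
    fun a b => sum_ivdw_twoForm _ (fun c d => by rw [hT.antisymm_right]; simp) _ _
  simp only [h1]
  rw [sum_ivdw_twoForm]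
  swap
  · intro a b
    simp only [hT.antisymm a b]
    unfold twoFormSpinor selfDual
    generalize A 2 = p
    generalize A 3 = q
    fin_cases p <;> fin_cases q <;> simp <;> ring
  have key : ∀ p q r s, twoFormSpinor (selfDual fun a b =>
      twoFormSpinor (selfDual fun c d => (T a b c d : ℂ)) r s) p q =
        twoFormSpinor (fun i => twoFormSpinor (fun j => weylMatrix T i j) r s) p q := by
    intro p q r s
    congr 2
    funext i
    unfold weylMatrix twoFormSpinor
    fin_cases i <;> fin_cases r <;> fin_cases s <;> simp [selfDual] <;> ring
  rw [key]
  have h01 := hT.weylMatrix_symm 1 0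
  have h02 := hT.weylMatrix_symm 2 0
  have h12 := hT.weylMatrix_symm 2 1
  have ht : weylMatrix T 2 2 = -weylMatrix T 0 0 - weylMatrix T 1 1 := by
    linear_combination hT.weylMatrix_trace
  have hI := Complex.I_sq
  unfold ofComp twoFormSpinor
  simp only [Fin.sum_univ_four, h01, h02, h12]
  generalize A 0 = a, A 1 = b, A 2 = c, A 3 = d
  fin_cases a <;> fin_cases b <;> fin_cases c <;> fin_cases d <;>
    simp only [Fin.mk_zero, Fin.mk_one, Matrix.cons_val, Nat.reduceAdd, spinorComp, ht]
  all_goals first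
    | ring1
    | linear_combination (weylMatrix T 1 1 / 4) * hI

/-! ### The Bianchi identity for the Weyl spinor in vacuum -/

theorem HasDirDeriv.ofReal {E : Type*} [NormedAddCommGroup E] [NormedSpace ℝ E] {H : Type*}
    [TopologicalSpace H] {I : ModelWithCorners ℝ E H} {X : Type*} [TopologicalSpace X]
    [ChartedSpace H X] {x : X} {v : TangentSpace I x} {f : X → ℝ} {f' : ℝ}
    (hf : HasDirDeriv v f f') : HasDirDeriv v (fun y => (f y : ℂ)) (f' : ℂ) := by
  have h := Complex.ofRealCLM.hasMFDerivAt (x := f x) |>.comp x hf.1.hasMFDerivAt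
  refine ⟨h.mdifferentiableAt, ?_⟩
  have h2 := congrArg (fun L => L v) h.mfderiv
  rw [← hf.2]
  exact h2

namespace Tetrad

variable {M : Type*} [TopologicalSpace M]
  [ChartedSpace (EuclideanSpace ℝ (Fin 4)) M] [IsManifold (𝓡 4) ∞ M]
  {g : LorentzMetric M} (e : Tetrad g)

theorem isWeylTensor_riemann (hvac : e.IsVacuum) (x : M) :
    IsWeylTensor fun a b c d => e.riemann a b c d x where
  antisymm a b c d := e.riemann_antisymm_left a b c d x
  pair_symm a b c d := e.riemann_pair_symm a b c d x
  cyclic a b c d := e.riemann_cyclic a b c d x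
  trace a c := hvac x a c

theorem frameDeriv_congr {f h : M → ℝ} (k : Fin 4) (hfh : ∀ x, f x = h x) (x : M) :
    e.frameDeriv k f x = e.frameDeriv k h x := by rw [funext hfh]

/-- The covariant derivative preserves the algebraic symmetries of the curvature: the connection
terms act as an infinitesimal Lorentz transformation. -/
theorem isWeylTensor_covRiemann (hvac : e.IsVacuum) (k : Fin 4) (x : M) :
    IsWeylTensor fun a b c d => e.covRiemann k a b c d x where
  antisymm a b c d := by
    have h := ((SmoothFun.hasDirDeriv e (e.smooth_riemann b a c d) k x).neg).2
    have h1 := e.frameDeriv_congr k (e.riemann_antisymm_left a b c d) x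
    rw [show e.frameDeriv k (fun y => -e.riemann b a c d y) x = _ from h] at h1
    have l := fun a b c d => e.riemann_antisymm_left a b c d x
    rw [covRiemann, covRiemann, h1, neg_sub, sub_eq_add_neg, ← Finset.sum_neg_distrib, add_comm,
      ← sub_eq_add_neg]
    congr 1
    refine Finset.sum_congr rfl fun f _ => ?_
    rw [l f b, l a f, l a b f, l a b c f]
    ring
  pair_symm a b c d := by
    rw [covRiemann, covRiemann, e.frameDeriv_congr k (e.riemann_pair_symm a b c d) x]
    congr 1
    refine Finset.sum_congr rfl fun f _ => ?_
    rw [e.riemann_pair_symm f b, e.riemann_pair_symm a f, e.riemann_pair_symm a b f,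
      e.riemann_pair_symm a b c f]
    ring
  cyclic a b c d := by
    have h := fun a b c d => SmoothFun.hasDirDeriv e (e.smooth_riemann a b c d) k x
    have h1 := (((h a b c d).add (h b c a d)).add (h c a b d)).2
    have h2 : e.frameDeriv k (fun y => e.riemann a b c d y + e.riemann b c a d y
        + e.riemann c a b d y) x = 0 := by
      rw [e.frameDeriv_congr k (e.riemann_cyclic a b c d) x]
      exact (HasDirDeriv.const 0).2
    rw [show e.frameDeriv k _ x = _ from h1] at h2
    have cy := fun a b c d => e.riemann_cyclic a b c d x
    have hs : ∀ f, eta f *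
        (e.omega k a f x * e.riemann f b c d x + e.omega k b f x * e.riemann a f c d x
          + e.omega k c f x * e.riemann a b f d x + e.omega k d f x * e.riemann a b c f x)
        = -(eta f *
        (e.omega k b f x * e.riemann f c a d x + e.omega k c f x * e.riemann b f a d x
          + e.omega k a f x * e.riemann b c f d x + e.omega k d f x * e.riemann b c a f x))
        - (eta f *
        (e.omega k c f x * e.riemann f a b d x + e.omega k a f x * e.riemann c f b d x
          + e.omega k b f x * e.riemann c a f d x + e.omega k d f x * e.riemann c a b f x)) :=
      fun f => by
        linear_combination eta f * (e.omega k a f x * cy f b c d + e.omega k b f x * cy a f c d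
          + e.omega k c f x * cy a b f d + e.omega k d f x * cy a b c f)
    simp only [covRiemann]
    rw [Finset.sum_congr rfl fun f _ => hs f, Finset.sum_sub_distrib, Finset.sum_neg_distrib]
    linear_combination h2
  trace a c := by
    have h := fun b => SmoothFun.hasDirDeriv e (e.smooth_riemann a b c b) k x
    have h1 := (HasDirDeriv.sum Finset.univ
      fun b _ => (HasDirDeriv.const (eta b)).mul (h b)).2
    have h2 : e.frameDeriv k (fun y => ∑ b, eta b * e.riemann a b c b y) x = 0 := by
      rw [e.frameDeriv_congr k (fun y => hvac y a c) x]
      exact (HasDirDeriv.const 0).2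
    rw [show e.frameDeriv k _ x = _ from h1] at h2
    have t1 := fun f => hvac x f c
    have t2 := fun f => hvac x a f
    have w := fun b c => e.omega_antisymm k b c x
    have wd : ∀ b, e.omega k b b x = 0 := fun b => by linarith [w b b]
    simp only [Fin.sum_univ_four, eta_zero, eta_one, eta_two, eta_three] at h2 t1 t2
    simp only [covRiemann, Fin.sum_univ_four, eta_zero, eta_one, eta_two, eta_three, wd,
      w 1 0, w 2 0, w 3 0, w 2 1, w 3 1, w 3 2]
    linear_combination h2 - e.omega k a 0 x * t1 0 + e.omega k a 1 x * t1 1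
      + e.omega k a 2 x * t1 2 + e.omega k a 3 x * t1 3 - e.omega k c 0 x * t2 0
      + e.omega k c 1 x * t2 1 + e.omega k c 2 x * t2 2 + e.omega k c 3 x * t2 3

/-- The contracted second Bianchi identity in vacuum. -/
theorem sum_covRiemann_divergence (hvac : e.IsVacuum) (a b d : Fin 4) (x : M) :
    ∑ c, eta c * e.covRiemann c a b c d x = 0 := by
  have h := fun c => e.covRiemann_cyclic c a b c d x
  have h1 := (e.isWeylTensor_covRiemann hvac a x).trace b d
  have h2 := (e.isWeylTensor_covRiemann hvac b x).trace a d
  have h3 := fun c => (e.isWeylTensor_covRiemann hvac a x).antisymm_right b c c d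
  have h4 := fun c => (e.isWeylTensor_covRiemann hvac b x).antisymm_right c a c d
  have h5 := fun c => (e.isWeylTensor_covRiemann hvac b x).antisymm c a d c
  have h6 : ∀ c, e.covRiemann c a b c d x =
      e.covRiemann a b c d c x - e.covRiemann b a c d c x := fun c => by
    linarith [h c, h3 c, h4 c, h5 c]
  simp only [h6, mul_sub, Finset.sum_sub_distrib, h1, h2, sub_zero]

/-- The spin connection is the self-dual part of the Levi-Civita connection. -/
theorem spinConnection_eq (a : Fin 4) (B C : Fin 2) (x : M) :
    e.spinConnection a B C x = ∑ D, eps C D * (2⁻¹ *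
      twoFormSpinor (selfDual fun b c => (e.omega a b c x : ℂ)) B D) := by
  unfold spinConnection
  refine Finset.sum_congr rfl fun D _ => ?_
  rw [← sum_ivdw_twoForm _ (fun b c => by rw [e.omega_antisymm]; simp)]
  congr 2
  simp only [Finset.sum_mul]
  simp only [Fin.sum_univ_two, Fin.sum_univ_four]
  ring

/-- The components of the Weyl spinor, indexed by the number of spinor indices equal to `1`. -/
def weylComp (k : ℕ) (x : M) : ℂ :=
  spinorComp (weylMatrix fun a b c d => e.riemann a b c d x) k

theorem weylSpinor_eq_ofComp (hvac : e.IsVacuum) (x : M) :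
    e.weylSpinor x = ofComp fun k => e.weylComp k x := by
  unfold weylSpinor weylComp
  rw [← symmetrize_ofComp]
  congr 1
  funext A
  exact (e.isWeylTensor_riemann hvac x).sum_ivdw A

end Tetrad

section

variable {E : Type*} [NormedAddCommGroup E] [NormedSpace ℝ E] {H : Type*}
    [TopologicalSpace H] {I : ModelWithCorners ℝ E H} {X : Type*} [TopologicalSpace X]
    [ChartedSpace H X] {x : X} {v : TangentSpace I x}

theorem HasDirDeriv.selfDual {F : X → Fin 4 → Fin 4 → ℂ} {F' : Fin 4 → Fin 4 → ℂ}
    (hF : ∀ a b, HasDirDeriv v (fun y => F y a b) (F' a b)) (i : Fin 3) :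
    HasDirDeriv v (fun y => selfDual (F y) i) (selfDual F' i) := by
  have h := fun a b c d => (hF a b).add ((HasDirDeriv.const Complex.I).mul (hF c d))
  simp only [zero_mul, zero_add] at h
  fin_cases i
  · exact h 0 1 2 3
  · exact h 0 2 3 1
  · exact h 0 3 1 2

theorem HasDirDeriv.spinorComp {W : X → Fin 3 → Fin 3 → ℂ} {W' : Fin 3 → Fin 3 → ℂ}
    (hW : ∀ i j, HasDirDeriv v (fun y => W y i j) (W' i j)) (k : ℕ) :
    HasDirDeriv v (fun y => spinorComp (W y) k) (spinorComp W' k) := by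
  have hc := fun c : ℂ => HasDirDeriv.const (v := v) c
  match k with
  | 0 =>
    have := ((((hW 0 0).sub (hW 1 1)).sub ((hc (2 * Complex.I)).mul (hW 0 1))).mul (hc 4⁻¹))
    simpa [SpaceSpinor.spinorComp, div_eq_mul_inv] using this
  | 1 =>
    have := (((hW 0 2).neg.add ((hc Complex.I).mul (hW 1 2))).mul (hc 4⁻¹))
    simpa [SpaceSpinor.spinorComp, div_eq_mul_inv] using this
  | 2 =>
    have := ((hW 2 2).mul (hc 4⁻¹))
    simpa [SpaceSpinor.spinorComp, div_eq_mul_inv] using this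
  | 3 =>
    have := (((hW 0 2).add ((hc Complex.I).mul (hW 1 2))).mul (hc 4⁻¹))
    simpa [SpaceSpinor.spinorComp, div_eq_mul_inv] using this
  | 4 =>
    have := ((((hW 0 0).sub (hW 1 1)).add ((hc (2 * Complex.I)).mul (hW 0 1))).mul (hc 4⁻¹))
    simpa [SpaceSpinor.spinorComp, div_eq_mul_inv] using this
  | _ + 5 => exact hc 0

end

/-- The components of the covariant derivative of a totally symmetric spinor of valence `n` with
components `q`, whose derivatives are `dq`, where `G` is the spin connection. -/
def covComp (n : ℕ) (q dq : ℕ → ℂ) (G : Fin 2 → Fin 2 → ℂ) (k : ℕ) : ℂ :=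
  dq k - ((n - k) * (G 0 0 * q k + G 0 1 * q (k + 1)) + k * (G 1 0 * q (k - 1) + G 1 1 * q k))

/-- The connection terms of a totally symmetric spinor: with `m` indices equal to `1`, the `n - m`
indices equal to `0` contribute equally, and so do the others. -/
theorem sum_connection_ofComp {n : ℕ} (q : ℕ → ℂ) (G : Fin 2 → Fin 2 → ℂ) (A : Fin n → Fin 2) :
    ∑ k, ∑ C, G (A k) C * (ofComp q : Spinor n) (Function.update A k C) =
      (n - (∑ k, (A k : ℕ) : ℕ)) * (G 0 0 * q (∑ k, (A k : ℕ)) + G 0 1 * q (∑ k, (A k : ℕ) + 1))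
        + (∑ k, (A k : ℕ) : ℕ) *
          (G 1 0 * q (∑ k, (A k : ℕ) - 1) + G 1 1 * q (∑ k, (A k : ℕ))) := by
  set m := ∑ k, (A k : ℕ) with hm
  have hu : ∀ k C, ofComp q (Function.update A k C) = q (m - (A k : ℕ) + (C : ℕ)) := by
    intro k C
    unfold ofComp
    congr 1
    have h1 : ∑ j, ((Function.update A k C j : Fin 2) : ℕ) =
        (C : ℕ) + ∑ j ∈ Finset.univ.erase k, (A j : ℕ) := by
      rw [← Finset.add_sum_erase _ _ (Finset.mem_univ k)]
      congr 1
      · simp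
      · refine Finset.sum_congr rfl fun j hj => ?_
        rw [Function.update_of_ne (Finset.ne_of_mem_erase hj)]
    have h2 : m = (A k : ℕ) + ∑ j ∈ Finset.univ.erase k, (A j : ℕ) :=
      (Finset.add_sum_erase _ _ (Finset.mem_univ k)).symm
    omega
  have hle : ∀ k, (A k : ℕ) ≤ m := fun k =>
    Finset.single_le_sum (f := fun k => (A k : ℕ)) (fun _ _ => Nat.zero_le _) (Finset.mem_univ k)
  -- `A k` is `0` or `1`, so that `1 - A k` and `A k` select the two cases.
  have hterm : ∀ k, ∑ C, G (A k) C * ofComp q (Function.update A k C) =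
      (1 - ((A k : ℕ) : ℂ)) * (G 0 0 * q m + G 0 1 * q (m + 1))
        + ((A k : ℕ) : ℂ) * (G 1 0 * q (m - 1) + G 1 1 * q m) := by
    intro k
    have hk := hle k
    simp only [hu, Fin.sum_univ_two]
    generalize A k = a at *
    fin_cases a
    · simp
    · have hk' : 1 ≤ m := hk
      simp [Nat.sub_add_cancel hk']
  simp only [hterm, Finset.sum_add_distrib, ← Finset.sum_mul, Finset.sum_sub_distrib]
  simp [hm]

namespace Tetrad

variable {M : Type*} [TopologicalSpace M]
  [ChartedSpace (EuclideanSpace ℝ (Fin 4)) M] [IsManifold (𝓡 4) ∞ M]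
  {g : LorentzMetric M} (e : Tetrad g)

theorem covDeriv_ofComp {n : ℕ} {q : ℕ → M → ℂ} (x : M) (v : TangentSpace (𝓡 4) x) :
    e.covDeriv (fun y => (ofComp fun k => q k y : Spinor n)) x v =
      ofComp (covComp n (fun k => q k x) (fun k => mvfderiv (𝓡 4) (q k) x v)
        (e.spinConnectionAlong x v)) := by
  funext A
  unfold covDeriv
  rw [sum_connection_ofComp (fun k => q k x) (e.spinConnectionAlong x v) A]
  rfl

theorem hasDirDeriv_weylComp (k : ℕ) (x : M) (v : TangentSpace (𝓡 4) x) :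
    HasDirDeriv v (e.weylComp k) (spinorComp (weylMatrix fun a b c d =>
      mvfderiv (𝓡 4) (e.riemann a b c d) x v) k) := by
  refine HasDirDeriv.spinorComp (fun i j => ?_) k
  refine HasDirDeriv.selfDual (fun a b => ?_) i
  refine HasDirDeriv.selfDual (fun c d => ?_) j
  exact HasDirDeriv.ofReal ⟨SmoothFun.mdiff (e.smooth_riemann a b c d) x, rfl⟩

theorem spinConnectionAlong_vec (x : M) (a : Fin 4) (B C : Fin 2) :
    e.spinConnectionAlong x (e.vec a x) B C = e.spinConnection a B C x := by
  unfold spinConnectionAlong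
  rw [Finset.sum_eq_single a]
  · simp [e.orthonormal, eta_mul_self]
  · intro b _ hb
    simp [e.orthonormal, hb.symm]
  · simp

/-- The covariant derivative in terms of self-dual parts: the connection terms act on both indices
of the double self-dual part through the cross product. -/
theorem weylMatrix_covRiemann (k : Fin 4) (x : M) (i j : Fin 3) :
    weylMatrix (fun a b c d => e.covRiemann k a b c d x) i j =
      weylMatrix (fun a b c d => e.frameDeriv k (e.riemann a b c d) x) i j
      + Complex.I * cross (selfDual fun a b => (e.omega k a b x : ℂ))
          (fun l => weylMatrix (fun a b c d => e.riemann a b c d x) l j) i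
      + Complex.I * cross (selfDual fun a b => (e.omega k a b x : ℂ))
          (weylMatrix (fun a b c d => e.riemann a b c d x) i) j := by
  set w := fun a b => e.omega k a b x with hw
  have hwa : ∀ a b, w a b = -w b a := fun a b => e.omega_antisymm k a b x
  set R : Fin 4 → Fin 4 → Fin 4 → Fin 4 → ℂ := fun a b c d => (e.riemann a b c d x : ℂ) with hR
  set D : Fin 4 → Fin 4 → Fin 4 → Fin 4 → ℂ :=
    fun a b c d => ((e.frameDeriv k (e.riemann a b c d) x : ℝ) : ℂ) with hD
  have hcov : ∀ a b c d, (e.covRiemann k a b c d x : ℂ) = D a b c d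
      - rot w (fun a b => R a b c d) a b - rot w (R a b) c d := by
    intro a b c d
    simp only [covRiemann, rot, hw, hR, hD]
    push_cast
    rw [sub_sub, ← Finset.sum_add_distrib]
    congr 1
    refine Finset.sum_congr rfl fun f _ => ?_
    ring
  have hRr : ∀ a b c d, R a b c d = -R a b d c := fun a b c d => by
    simp only [hR]; rw [e.riemann_antisymm_right]; simp
  have hRl : ∀ a b c d, R a b c d = -R b a c d := fun a b c d => by
    simp only [hR]; rw [e.riemann_antisymm_left]; simp
  have h1 : ∀ a b, selfDual (fun c d => (e.covRiemann k a b c d x : ℂ)) j =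
      selfDual (D a b) j - rot w (fun a b => selfDual (R a b) j) a b
        + Complex.I * cross (selfDual fun a b => (w a b : ℂ)) (selfDual (R a b)) j := by
    intro a b
    have h2 := congrFun (selfDual_rot w hwa (R a b) (hRr a b)) j
    have h3 : selfDual (fun c d => (e.covRiemann k a b c d x : ℂ)) j =
        selfDual (D a b) j - rot w (fun a b => selfDual (R a b) j) a b
          - selfDual (rot w (R a b)) j := by
      simp only [hcov, selfDual, rot, Fin.sum_univ_four]
      fin_cases j <;> simp <;> ring
    rw [h3, h2]; ring
  have h4 := congrFun (selfDual_rot w hwa (fun a b => selfDual (R a b) j) (fun a b => by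
    simp only [hRl a b, selfDual]; fin_cases j <;> simp <;> ring)) i
  unfold weylMatrix
  simp only [h1]
  have h5 : selfDual (fun a b => selfDual (D a b) j - rot w (fun a b => selfDual (R a b) j) a b
        + Complex.I * cross (selfDual fun a b => (w a b : ℂ)) (selfDual (R a b)) j) i =
      selfDual (fun a b => selfDual (D a b) j) i
      - selfDual (rot w (fun a b => selfDual (R a b) j)) i
      + Complex.I * cross (selfDual fun a b => (w a b : ℂ))
          (fun l => selfDual (fun a b => selfDual (R a b) l) i) j := by
    generalize (selfDual fun a b => (w a b : ℂ)) = u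
    generalize hF : rot w (fun a b => selfDual (R a b) j) = F
    clear hF h4 h1 hcov
    unfold selfDual cross
    fin_cases i <;> fin_cases j <;> simp <;> ring
  rw [h5, h4]
  simp only [hD, hR, hw]
  ring

/-- The covariant derivative of the Weyl spinor is the spinor equivalent of the covariant
derivative of the Riemann tensor. -/
theorem covDeriv_weylSpinor_vec (hvac : e.IsVacuum) (x : M) (a : Fin 4) :
    e.covDeriv e.weylSpinor x (e.vec a x) =
      ofComp (spinorComp (weylMatrix fun b c d f => e.covRiemann a b c d f x)) := by
  have h : e.weylSpinor = fun y => ofComp fun k => e.weylComp k y :=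
    funext fun y => e.weylSpinor_eq_ofComp hvac y
  rw [h, covDeriv_ofComp]
  funext A
  have hle : ∑ k, (A k : ℕ) ≤ 4 := sum_val_le A
  unfold ofComp
  generalize ∑ k, (A k : ℕ) = m at *
  have hd : ∀ k, mvfderiv (𝓡 4) (e.weylComp k) x (e.vec a x) = spinorComp (weylMatrix
      fun b c d f => e.frameDeriv a (e.riemann b c d f) x) k := fun k =>
    (e.hasDirDeriv_weylComp k x (e.vec a x)).2
  have hW := e.isWeylTensor_riemann hvac x
  have h01 := hW.weylMatrix_symm 1 0
  have h02 := hW.weylMatrix_symm 2 0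
  have h12 := hW.weylMatrix_symm 2 1
  have ht : weylMatrix (fun a b c d => e.riemann a b c d x) 2 2 =
      -weylMatrix (fun a b c d => e.riemann a b c d x) 0 0
      - weylMatrix (fun a b c d => e.riemann a b c d x) 1 1 := by
    linear_combination hW.weylMatrix_trace
  have hcW := e.weylMatrix_covRiemann a x
  unfold covComp
  simp only [hd, spinConnectionAlong_vec, spinConnection_eq, weylComp]
  generalize weylMatrix (fun b c d f => e.covRiemann a b c d f x) = cW at *
  generalize weylMatrix (fun a b c d => e.riemann a b c d x) = W at *
  generalize weylMatrix (fun b c d f => e.frameDeriv a (e.riemann b c d f) x) = dW at *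
  generalize (selfDual fun b c => (e.omega a b c x : ℂ)) = u at *
  have hI := Complex.I_sq
  interval_cases m <;>
    simp [spinorComp, hcW, twoFormSpinor, eps, cross, h01, h02, h12, ht, Fin.sum_univ_two]
  all_goals
    first
    | ring1
    | (ring_nf; simp only [Complex.I_sq]; ring1)

/-- The vacuum Bianchi identity `∇^A_{A'} Ψ_{ABCD} = 0` in components; `k` is the number of indices
`B`, `C`, `D` equal to `1`. It is the self-dual part of `sum_covRiemann_divergence`. -/
theorem weyl_bianchi_comp (hvac : e.IsVacuum) (x : M) (i : Fin 2) (k : ℕ) (hk : k < 4) :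
    ∑ A : Fin 2, ∑ B, eps A B * ∑ b, ivdw b B i *
      spinorComp (weylMatrix fun a c d f => e.covRiemann b a c d f x) (k + A) = 0 := by
  have hdiv : ∀ j d, ∑ c, (eta c : ℂ) *
      leftSelfDual (fun a b c' d => e.covRiemann c a b c' d x) j c d = 0 := by
    intro j d
    have h := fun a b => e.sum_covRiemann_divergence hvac a b d x
    have h' : ∀ a b, ∑ c, (eta c : ℂ) * (e.covRiemann c a b c d x : ℂ) = 0 := fun a b => by
      exact_mod_cast h a b
    unfold leftSelfDual selfDual
    simp only [Fin.sum_univ_four] at h' ⊢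
    fin_cases j <;> simp
    · linear_combination h' 0 1 + Complex.I * h' 2 3
    · linear_combination h' 0 2 + Complex.I * h' 3 1
    · linear_combination h' 0 3 + Complex.I * h' 1 2
  have hw := fun b => e.isWeylTensor_covRiemann hvac b x
  have hsym := fun b => (hw b).weylMatrix_symm
  have htr := fun b => (hw b).weylMatrix_trace
  have hd := fun b => (hw b).leftSelfDual_dual
  have he := fun b => (hw b).leftSelfDual_eq
  have ha := fun b => (hw b).leftSelfDual_antisymm
  have had : ∀ b j c, leftSelfDual (fun a b' c' d => e.covRiemann b a b' c' d x) j c c = 0 :=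
    fun b j c => by linear_combination (1 / 2 : ℂ) * ha b j c c
  have ha10 := fun b j => ha b j 1 0
  have ha20 := fun b j => ha b j 2 0
  have ha30 := fun b j => ha b j 3 0
  have ha21 := fun b j => ha b j 2 1
  have ha13 := fun b j => ha b j 1 3
  have ha32 := fun b j => ha b j 3 2
  have d0 := fun j => hdiv j 0
  have d1 := fun j => hdiv j 1
  have d2 := fun j => hdiv j 2
  have d3 := fun j => hdiv j 3
  simp only [Fin.sum_univ_four, had, ha10, ha20, ha30, ha21, ha13, ha32, (hd _ _).1, (hd _ _).2.1,
    (hd _ _).2.2, (he _ _).1, (he _ _).2.1, (he _ _).2.2, eta_zero, eta_one, eta_two, eta_three]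
    at d0 d1 d2 d3
  push_cast at d0 d1 d2 d3
  clear hdiv hw hd he ha had ha10 ha20 ha30 ha21 ha13 ha32
  generalize hWdef : (fun b => weylMatrix fun a c d f => e.covRiemann b a c d f x) = W at *
  have hW : ∀ b, (weylMatrix fun a c d f => e.covRiemann b a c d f x) = W b :=
    fun b => congrFun hWdef b
  simp only [hW] at *
  clear hW hWdef
  have h01 := fun b => hsym b 1 0
  have h02 := fun b => hsym b 2 0
  have h12 := fun b => hsym b 2 1
  have ht : ∀ b, W b 2 2 = -W b 0 0 - W b 1 1 := fun b => by linear_combination htr b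
  clear hsym htr
  have hI := Complex.I_sq
  simp only [ivdw]
  generalize ((Real.sqrt 2 : ℝ) : ℂ)⁻¹ = r
  have e00 := d0 0
  have e01 := d0 1
  have e10 := d1 0
  have e11 := d1 1
  have e20 := d2 0
  have e21 := d2 1
  have e30 := d3 0
  have e31 := d3 1
  simp only [h01] at e00 e01 e10 e11 e20 e21 e30 e31
  interval_cases k <;> fin_cases i <;>
    simp [Fin.sum_univ_two, Fin.sum_univ_four, eps, spinorComp, ht]
  · linear_combination (norm := (ring_nf; simp only [Complex.I_sq]; ring1))
      (r / 2) * (e00 + e30 - (Complex.I * e01) - (Complex.I * e31))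
  · linear_combination (norm := (ring_nf; simp only [Complex.I_sq]; ring1))
      (r / 2) * (e10 - (Complex.I * e20) - (Complex.I * e11) - e21)
  · linear_combination (norm := (ring_nf; simp only [Complex.I_sq]; ring1))
      (r / 2) * (e10 + (Complex.I * e20) - (Complex.I * e11) + e21)
  · linear_combination (norm := (ring_nf; simp only [Complex.I_sq]; ring1))
      (r / 2) * (e00 - e30 - (Complex.I * e01) + (Complex.I * e31))
  · linear_combination (norm := (ring_nf; simp only [Complex.I_sq]; ring1))
      (r / 2) * (-e00 - e30 - (Complex.I * e01) - (Complex.I * e31))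
  · linear_combination (norm := (ring_nf; simp only [Complex.I_sq]; ring1))
      (r / 2) * (-e10 + (Complex.I * e20) - (Complex.I * e11) - e21)
  · linear_combination (norm := (ring_nf; simp only [Complex.I_sq]; ring1))
      (r / 2) * (-e10 - (Complex.I * e20) - (Complex.I * e11) + e21)
  · linear_combination (norm := (ring_nf; simp only [Complex.I_sq]; ring1))
      (r / 2) * (-e00 + e30 - (Complex.I * e01) + (Complex.I * e31))

end Tetrad

/-! ### Totally symmetric spinors and binary forms -/

/-- The binary form `T_{A₁ … Aₙ} z^{A₁} ⋯ z^{Aₙ}`. -/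
def binaryForm {n : ℕ} (T : Spinor n) (z : Fin 2 → ℂ) : ℂ := ∑ A, T A * ∏ k, z (A k)

theorem binaryForm_symmetrize {n : ℕ} (T : Spinor n) (z : Fin 2 → ℂ) :
    binaryForm (symmetrize T) z = binaryForm T z := by
  have h : ∀ π : Equiv.Perm (Fin n), ∑ A : Fin n → Fin 2, T (A ∘ π) * ∏ k, z (A k) =
      binaryForm T z := by
    intro π
    refine Fintype.sum_equiv (Equiv.arrowCongr π.symm (Equiv.refl _)) _ _ fun A => ?_
    have : ∏ k, z (A k) = ∏ k, z (A (π k)) := (Equiv.prod_comp π fun k => z (A k)).symm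
    rw [this]
    rfl
  unfold binaryForm symmetrize
  simp only [mul_assoc, ← Finset.mul_sum, Finset.sum_mul]
  rw [Finset.sum_comm]
  simp only [h, Finset.sum_const, Finset.card_univ, Fintype.card_perm, Fintype.card_fin,
    nsmul_eq_mul]
  rw [← mul_assoc, inv_mul_cancel₀ (by exact_mod_cast Nat.factorial_ne_zero n), one_mul]
  rfl

theorem binaryForm_symProd {n : ℕ} (v : Fin n → Fin 2 → ℂ) (z : Fin 2 → ℂ) :
    binaryForm (symProd v) z = ∏ k, ∑ B, v k B * z B := by
  unfold symProd
  rw [binaryForm_symmetrize, Finset.prod_univ_sum, Fintype.piFinset_univ]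
  simp [binaryForm, Finset.prod_mul_distrib]

theorem sum_pi_succ {n : ℕ} (f : (Fin (n + 1) → Fin 2) → ℂ) :
    ∑ A, f A = ∑ a, ∑ B : Fin n → Fin 2, f (Matrix.vecCons a B) := by
  rw [← Fintype.sum_prod_type' (f := fun a B => f (Matrix.vecCons a B))]
  exact Fintype.sum_equiv (Fin.consEquiv fun _ => Fin 2).symm _ _ fun A => by
    simp [Fin.consEquiv, Matrix.vecCons]

theorem binaryForm_ofComp_four (q : ℕ → ℂ) (z : Fin 2 → ℂ) :
    binaryForm (ofComp q : Spinor 4) z = q 0 * z 0 ^ 4 + 4 * q 1 * z 0 ^ 3 * z 1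
      + 6 * q 2 * z 0 ^ 2 * z 1 ^ 2 + 4 * q 3 * z 0 * z 1 ^ 3 + q 4 * z 1 ^ 4 := by
  simp [binaryForm, ofComp, sum_pi_succ, Fin.sum_univ_two, Fin.sum_univ_four, Fin.prod_univ_four]
  ring

theorem binaryForm_ofComp_six (q : ℕ → ℂ) (z : Fin 2 → ℂ) :
    binaryForm (ofComp q : Spinor 6) z = q 0 * z 0 ^ 6 + 6 * q 1 * z 0 ^ 5 * z 1
      + 15 * q 2 * z 0 ^ 4 * z 1 ^ 2 + 20 * q 3 * z 0 ^ 3 * z 1 ^ 3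
      + 15 * q 4 * z 0 ^ 2 * z 1 ^ 4 + 6 * q 5 * z 0 * z 1 ^ 5 + q 6 * z 1 ^ 6 := by
  simp [binaryForm, ofComp, sum_pi_succ, Fin.sum_univ_two, Fin.sum_univ_six, Fin.prod_univ_six]
  ring

theorem exists_perm_of_sum_eq {n : ℕ} (A B : Fin n → Fin 2)
    (h : ∑ k, (A k : ℕ) = ∑ k, (B k : ℕ)) : ∃ π : Equiv.Perm (Fin n), B = A ∘ π := by
  have hc : ∀ A : Fin n → Fin 2, Fintype.card {k // A k = 1} = ∑ k, (A k : ℕ) := by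
    intro A
    rw [Fintype.card_subtype, Finset.card_filter]
    refine Finset.sum_congr rfl fun k _ => ?_
    generalize A k = a
    fin_cases a <;> rfl
  have e : {k // B k = 1} ≃ {k // A k = 1} := Fintype.equivOfCardEq (by rw [hc, hc, h])
  refine ⟨e.extendSubtype, funext fun k => ?_⟩
  by_cases hk : B k = 1
  · rw [hk]; exact (e.extendSubtype_mem k hk).symm
  · have h2 := e.extendSubtype_not_mem k hk
    simp only [Function.comp]
    have : ∀ a : Fin 2, a ≠ 1 → a = 0 := by decide
    rw [this _ hk, this _ h2]

/-- A totally symmetric spinor is determined by its components with a given number of indices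
equal to `1`. -/
theorem exists_eq_ofComp {n : ℕ} (T : Spinor n)
    (hT : ∀ (A : Fin n → Fin 2) (π : Equiv.Perm (Fin n)), T (A ∘ π) = T A) :
    ∃ q, T = ofComp q := by
  classical
  refine ⟨fun m => if h : ∃ A : Fin n → Fin 2, ∑ k, (A k : ℕ) = m then T h.choose else 0,
    funext fun A => ?_⟩
  have h : ∃ B : Fin n → Fin 2, ∑ k, (B k : ℕ) = ∑ k, (A k : ℕ) := ⟨A, rfl⟩
  simp only [ofComp]
  rw [dif_pos h]
  obtain ⟨π, hπ⟩ := exists_perm_of_sum_eq A h.choose h.choose_spec.symm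
  rw [hπ, hT]

theorem symmetrize_comp_perm {n : ℕ} (T : Spinor n) (A : Fin n → Fin 2)
    (π : Equiv.Perm (Fin n)) : symmetrize T (A ∘ π) = symmetrize T A := by
  unfold symmetrize
  congr 1
  exact Fintype.sum_equiv (Equiv.mulLeft π) _ _ fun σ => rfl

/-- The components of a symmetric spinor of valence four are determined by its binary form. -/
theorem binaryForm_injective_four {p q : ℕ → ℂ}
    (h : ∀ z, binaryForm (ofComp p : Spinor 4) z = binaryForm (ofComp q : Spinor 4) z) :
    ∀ k ≤ 4, p k = q k := by
  simp only [binaryForm_ofComp_four] at h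
  have h1 := h ![1, 0]
  have h2 := h ![0, 1]
  have h3 := h ![1, 1]
  have h4 := h ![1, -1]
  have h5 := h ![1, 2]
  simp at h1 h2 h3 h4 h5
  -- The coefficients are those of polynomial interpolation at these five points.
  intro k hk
  interval_cases k
  · exact h1
  · linear_combination h3 / 4 - h4 / 12 - h5 / 24 - h1 / 8 + h2 / 2
  · linear_combination (h3 + h4 - 2 * h1 - 2 * h2) / 12
  · linear_combination h5 / 24 - h4 / 24 - h3 / 8 + h1 / 8 - h2 / 2
  · exact h2

/-- The components of a symmetric spinor of valence six are determined by its binary form. -/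
theorem binaryForm_injective_six {p q : ℕ → ℂ}
    (h : ∀ z, binaryForm (ofComp p : Spinor 6) z = binaryForm (ofComp q : Spinor 6) z) :
    ∀ k ≤ 6, p k = q k := by
  simp only [binaryForm_ofComp_six] at h
  have h1 := h ![1, 0]
  have h2 := h ![0, 1]
  have h3 := h ![1, 1]
  have h4 := h ![1, -1]
  have h5 := h ![1, 2]
  have h6 := h ![1, -2]
  have h7 := h ![2, 1]
  simp at h1 h2 h3 h4 h5 h6 h7
  -- The coefficients are those of polynomial interpolation at these seven points.
  intro k hk
  interval_cases k
  · linear_combination h1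
  · linear_combination (-1 / 3) * h1 - (1 / 3) * h2 - (1 / 9) * h3 - (1 / 27) * h4
      + (1 / 216) * h5 + (1 / 360) * h6 + (1 / 135) * h7
  · linear_combination (-1 / 12) * h1 + (4 / 15) * h2 + (2 / 45) * h3 + (2 / 45) * h4
      - (1 / 360) * h5 - (1 / 360) * h6
  · linear_combination (1 / 8) * h1 + (1 / 8) * h2 + (3 / 40) * h3 + (-7 / 360) * h4
      - (1 / 360) * h5 - (1 / 360) * h7
  · linear_combination (1 / 60) * h1 - (1 / 3) * h2 - (1 / 90) * h3 - (1 / 90) * h4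
      + (1 / 360) * h5 + (1 / 360) * h6
  · linear_combination (-1 / 12) * h1 - (1 / 12) * h2 - (1 / 18) * h3 + (1 / 54) * h4
      + (1 / 216) * h5 - (1 / 360) * h6 + (1 / 540) * h7
  · linear_combination h2

/-- A totally symmetric spinor of valence six is determined by its binary form. -/
theorem eq_of_binaryForm_eq_six {S T : Spinor 6}
    (hS : ∀ (A : Fin 6 → Fin 2) (π : Equiv.Perm (Fin 6)), S (A ∘ π) = S A)
    (hT : ∀ (A : Fin 6 → Fin 2) (π : Equiv.Perm (Fin 6)), T (A ∘ π) = T A)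
    (h : ∀ z, binaryForm S z = binaryForm T z) : S = T := by
  obtain ⟨p, rfl⟩ := exists_eq_ofComp S hS
  obtain ⟨q, rfl⟩ := exists_eq_ofComp T hT
  funext A
  exact binaryForm_injective_six h _ (sum_val_le A)

/-- The components of the sextic covariant of a quartic with components `q`; for the Weyl spinor it
is `H_{ABCDEF}`, see `cubicConcomitant_ofComp`. -/
def sexticComp (q : ℕ → ℂ) : ℕ → ℂ
  | 0 => -q 0 ^ 2 * q 3 + 3 * q 0 * q 1 * q 2 - 2 * q 1 ^ 3
  | 1 => (-q 0 ^ 2 * q 4 - 2 * q 0 * q 1 * q 3 + 9 * q 0 * q 2 ^ 2 - 6 * q 1 ^ 2 * q 2) / 6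
  | 2 => (-q 0 * q 1 * q 4 + 3 * q 0 * q 2 * q 3 - 2 * q 1 ^ 2 * q 3) / 3
  | 3 => (q 0 * q 3 ^ 2 - q 1 ^ 2 * q 4) / 2
  | 4 => (q 0 * q 3 * q 4 - 3 * q 1 * q 2 * q 4 + 2 * q 1 * q 3 ^ 2) / 3
  | 5 => (q 0 * q 4 ^ 2 + 2 * q 1 * q 3 * q 4 - 9 * q 2 ^ 2 * q 4 + 6 * q 2 * q 3 ^ 2) / 6
  | 6 => q 1 * q 4 ^ 2 - 3 * q 2 * q 3 * q 4 + 2 * q 3 ^ 3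
  | _ => 0

set_option maxHeartbeats 1000000 in
theorem cubicConcomitant_ofComp (q : ℕ → ℂ) :
    cubicConcomitant (ofComp q) = ofComp (sexticComp q) := by
  refine eq_of_binaryForm_eq_six (fun A π => symmetrize_comp_perm _ A π)
    (fun A π => ofComp_comp_perm _ A π) fun z => ?_
  rw [binaryForm_ofComp_six]
  unfold cubicConcomitant
  rw [binaryForm_symmetrize]
  have hK : ∀ A : Fin 6 → Fin 2,
      ∑ P, ∑ Q, ∑ R, ∑ P', ∑ Q', ∑ R', eps P P' * eps Q Q' * eps R R' *
        ((ofComp q : Spinor 4) ![P, Q, R, A 0] * (ofComp q : Spinor 4) ![Q', R', A 1, A 2] *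
          (ofComp q : Spinor 4) ![P', A 3, A 4, A 5]) =
      (q (A 0) * q (A 1 + A 2 + 2 : ℕ) - 2 * q (A 0 + 1 : ℕ) * q (A 1 + A 2 + 1 : ℕ)
        + q (A 0 + 2 : ℕ) * q (A 1 + A 2 : ℕ)) * q (A 3 + A 4 + A 5 + 1 : ℕ)
      - (q (A 0 + 1 : ℕ) * q (A 1 + A 2 + 2 : ℕ) - 2 * q (A 0 + 2 : ℕ) * q (A 1 + A 2 + 1 : ℕ)
        + q (A 0 + 3 : ℕ) * q (A 1 + A 2 : ℕ)) * q (A 3 + A 4 + A 5 : ℕ) := by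
    intro A
    simp [Fin.sum_univ_two, Fin.sum_univ_four, eps, ofComp]
    ring_nf
  simp only [binaryForm, hK]
  simp [sum_pi_succ, Fin.sum_univ_two, Fin.prod_univ_six, sexticComp]
  ring

/-- The derivative of `sexticComp` at `q` in the direction `p`. -/
def sexticVar (q p : ℕ → ℂ) : ℕ → ℂ
  | 0 => -2 * q 0 * p 0 * q 3 - q 0 ^ 2 * p 3 + 3 * (p 0 * q 1 * q 2 + q 0 * p 1 * q 2
      + q 0 * q 1 * p 2) - 6 * q 1 ^ 2 * p 1
  | 1 => (-2 * q 0 * p 0 * q 4 - q 0 ^ 2 * p 4 - 2 * (p 0 * q 1 * q 3 + q 0 * p 1 * q 3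
      + q 0 * q 1 * p 3) + 9 * (p 0 * q 2 ^ 2 + 2 * q 0 * q 2 * p 2)
      - 6 * (2 * q 1 * p 1 * q 2 + q 1 ^ 2 * p 2)) / 6
  | 2 => (-(p 0 * q 1 * q 4 + q 0 * p 1 * q 4 + q 0 * q 1 * p 4) + 3 * (p 0 * q 2 * q 3
      + q 0 * p 2 * q 3 + q 0 * q 2 * p 3) - 2 * (2 * q 1 * p 1 * q 3 + q 1 ^ 2 * p 3)) / 3
  | 3 => (p 0 * q 3 ^ 2 + 2 * q 0 * q 3 * p 3 - 2 * q 1 * p 1 * q 4 - q 1 ^ 2 * p 4) / 2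
  | 4 => (p 0 * q 3 * q 4 + q 0 * p 3 * q 4 + q 0 * q 3 * p 4 - 3 * (p 1 * q 2 * q 4
      + q 1 * p 2 * q 4 + q 1 * q 2 * p 4) + 2 * (p 1 * q 3 ^ 2 + 2 * q 1 * q 3 * p 3)) / 3
  | 5 => (p 0 * q 4 ^ 2 + 2 * q 0 * q 4 * p 4 + 2 * (p 1 * q 3 * q 4 + q 1 * p 3 * q 4
      + q 1 * q 3 * p 4) - 9 * (2 * q 2 * p 2 * q 4 + q 2 ^ 2 * p 4)
      + 6 * (p 2 * q 3 ^ 2 + 2 * q 2 * q 3 * p 3)) / 6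
  | 6 => p 1 * q 4 ^ 2 + 2 * q 1 * q 4 * p 4 - 3 * (p 2 * q 3 * q 4 + q 2 * p 3 * q 4
      + q 2 * q 3 * p 4) + 6 * q 3 ^ 2 * p 3
  | _ => 0

/-- The sextic covariant is `SL(2)`-equivariant, infinitesimally: a trace-free connection term
may be taken inside. -/
theorem covComp_sexticComp (q dq : ℕ → ℂ) (G : Fin 2 → Fin 2 → ℂ) (hG : G 0 0 + G 1 1 = 0) :
    ∀ k ≤ 6, covComp 6 (sexticComp q) (sexticVar q dq) G k =
      sexticVar q (covComp 4 q dq G) k := by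
  have h11 : G 1 1 = -G 0 0 := by linear_combination hG
  intro k hk
  interval_cases k <;> simp [covComp, sexticComp, sexticVar, h11] <;> ring

theorem HasDirDeriv.of_eq {E H X 𝔸 : Type*} [NormedAddCommGroup E] [NormedSpace ℝ E]
    [TopologicalSpace H] {I : ModelWithCorners ℝ E H} [TopologicalSpace X] [ChartedSpace H X]
    [NormedCommRing 𝔸] [NormedAlgebra ℝ 𝔸]
    {x : X} {v : TangentSpace I x} {f h : X → 𝔸} {f' h' : 𝔸} (hf : HasDirDeriv v f f')
    (hfh : ∀ y, h y = f y) (hf' : h' = f') : HasDirDeriv v h h' := by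
  rw [hf', funext hfh]
  exact hf

theorem HasDirDeriv.sexticComp {E H X : Type*} [NormedAddCommGroup E] [NormedSpace ℝ E]
    [TopologicalSpace H] {I : ModelWithCorners ℝ E H} [TopologicalSpace X] [ChartedSpace H X]
    {x : X} {v : TangentSpace I x} {q : ℕ → X → ℂ} {p : ℕ → ℂ}
    (h : ∀ k, HasDirDeriv v (q k) (p k)) (k : ℕ) :
    HasDirDeriv v (fun y => SpaceSpinor.sexticComp (fun j => q j y) k)
      (sexticVar (fun j => q j x) p k) := by
  have m : ∀ (c : ℂ) (i j l : ℕ), HasDirDeriv v (fun y => c * (q i y * (q j y * q l y)))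
      (0 * (q i x * (q j x * q l x)) + c * (p i * (q j x * q l x) +
        q i x * (p j * q l x + q j x * p l))) := fun c i j l =>
    (HasDirDeriv.const c).mul ((h i).mul ((h j).mul (h l)))
  match k with
  | 0 =>
    exact ((m (-1) 0 0 3).add ((m 3 0 1 2).add (m (-2) 1 1 1))).of_eq
      (fun y => by simp only [SpaceSpinor.sexticComp]; ring) (by simp only [sexticVar]; ring)
  | 1 =>
    exact ((m (-1 / 6) 0 0 4).add ((m (-1 / 3) 0 1 3).add ((m (3 / 2) 0 2 2).add
      (m (-1) 1 1 2)))).of_eq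
      (fun y => by simp only [SpaceSpinor.sexticComp]; ring) (by simp only [sexticVar]; ring)
  | 2 =>
    exact ((m (-1 / 3) 0 1 4).add ((m 1 0 2 3).add (m (-2 / 3) 1 1 3))).of_eq
      (fun y => by simp only [SpaceSpinor.sexticComp]; ring) (by simp only [sexticVar]; ring)
  | 3 =>
    exact ((m (1 / 2) 0 3 3).add (m (-1 / 2) 1 1 4)).of_eq
      (fun y => by simp only [SpaceSpinor.sexticComp]; ring) (by simp only [sexticVar]; ring)
  | 4 =>
    exact ((m (1 / 3) 0 3 4).add ((m (-1) 1 2 4).add (m (2 / 3) 1 3 3))).of_eq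
      (fun y => by simp only [SpaceSpinor.sexticComp]; ring) (by simp only [sexticVar]; ring)
  | 5 =>
    exact ((m (1 / 6) 0 4 4).add ((m (1 / 3) 1 3 4).add ((m (-3 / 2) 2 2 4).add
      (m 1 2 3 3)))).of_eq
      (fun y => by simp only [SpaceSpinor.sexticComp]; ring) (by simp only [sexticVar]; ring)
  | 6 =>
    exact ((m 1 1 4 4).add ((m (-3) 2 3 4).add (m 2 3 3 3))).of_eq
      (fun y => by simp only [SpaceSpinor.sexticComp]; ring) (by simp only [sexticVar]; ring)
  | n + 7 => exact HasDirDeriv.const 0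

/-! ### Spinors of Petrov type D -/

/-- The components of `ψ o_{(A} o_B ι_C ι_{D)}`. -/
def typeDComp (ψ : ℂ) (o ι : Fin 2 → ℂ) : ℕ → ℂ
  | 0 => ψ * (o 0 ^ 2 * ι 0 ^ 2)
  | 1 => ψ * ((o 0 ^ 2 * ι 0 * ι 1 + o 0 * o 1 * ι 0 ^ 2) / 2)
  | 2 => ψ * ((o 0 ^ 2 * ι 1 ^ 2 + 4 * o 0 * o 1 * ι 0 * ι 1 + o 1 ^ 2 * ι 0 ^ 2) / 6)
  | 3 => ψ * ((o 0 * o 1 * ι 1 ^ 2 + o 1 ^ 2 * ι 0 * ι 1) / 2)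
  | 4 => ψ * (o 1 ^ 2 * ι 1 ^ 2)
  | _ => 0

theorem eq_typeDComp {q : ℕ → ℂ} {ψ : ℂ} {o ι : Fin 2 → ℂ}
    (h : ∀ A, (ofComp q : Spinor 4) A = ψ * symProd ![o, o, ι, ι] A) :
    ∀ k ≤ 4, q k = typeDComp ψ o ι k := by
  refine binaryForm_injective_four fun z => ?_
  have h1 : binaryForm (ofComp q : Spinor 4) z = ψ * binaryForm (symProd ![o, o, ι, ι]) z := by
    simp only [binaryForm, h, Finset.mul_sum, mul_assoc]
  rw [h1, binaryForm_symProd, binaryForm_ofComp_four]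
  simp [Fin.prod_univ_four, Fin.sum_univ_two, typeDComp]
  ring

theorem sexticVar_congr {q q' p : ℕ → ℂ} (h : ∀ k ≤ 4, q k = q' k) (k : ℕ) :
    sexticVar q p k = sexticVar q' p k := by
  unfold sexticVar
  rw [h 0 (by omega), h 1 (by omega), h 2 (by omega), h 3 (by omega), h 4 (by omega)]

theorem raise_zero (ξ : Fin 2 → ℂ) : raise ξ 0 = ξ 1 := by simp [raise, eps]

theorem raise_one (ξ : Fin 2 → ℂ) : raise ξ 1 = -ξ 0 := by simp [raise, eps]

/-- At a quartic of type D only the components of the variation along the fourth powers of the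
two principal spinors contribute to the variation of the sextic covariant. -/
theorem sexticVar_typeD (ψ : ℂ) (o ι : Fin 2 → ℂ) (h : o 0 * ι 1 - o 1 * ι 0 = 1) (p : ℕ → ℂ)
    (A : Fin 6 → Fin 2) :
    (ofComp (sexticVar (typeDComp ψ o ι) p) : Spinor 6) A =
      ψ ^ 2 / 4 * (binaryForm (ofComp p : Spinor 4) (raise ι) * symProd ![o, o, o, o, o, ι] A
        - binaryForm (ofComp p : Spinor 4) (raise o) * symProd ![o, ι, ι, ι, ι, ι] A) := by
  refine congrFun (eq_of_binaryForm_eq_six (T := fun A => ψ ^ 2 / 4 *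
    (binaryForm (ofComp p : Spinor 4) (raise ι) * symProd ![o, o, o, o, o, ι] A
        - binaryForm (ofComp p : Spinor 4) (raise o) * symProd ![o, ι, ι, ι, ι, ι] A))
    (fun A π => ofComp_comp_perm _ A π) (fun A π => by simp only [symProd, symmetrize_comp_perm])
    fun z => ?_) A
  have h1 : ∀ (c a b : ℂ) (S T : Spinor 6),
      binaryForm (fun A => c * (a * S A - b * T A)) z =
        c * (a * binaryForm S z - b * binaryForm T z) := by
    intro c a b S T
    simp only [binaryForm, Finset.mul_sum, ← Finset.sum_sub_distrib]
    exact Finset.sum_congr rfl fun A _ => by ring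
  rw [h1, binaryForm_symProd, binaryForm_symProd, binaryForm_ofComp_six]
  -- Multiplied by `o_A ι^A = 1`, the claim is a polynomial identity.
  have hL : ∀ L R : ℂ, (o 0 * ι 1 - o 1 * ι 0) * L = R → L = R := fun L R hR => by
    rw [← hR, h, one_mul]
  apply hL
  simp only [binaryForm_ofComp_four, raise_zero, raise_one, sexticVar, typeDComp]
  simp [Fin.prod_univ_six, Fin.sum_univ_two]
  ring

/-- Let `z = ξ^A`. If `Ψ_{ABCD} z^C z^D` is `ψ/6 ξ_A ξ_B` and `Ψ_{ABCD} z^B z^C z^D = 0` may be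
differentiated, then the contraction of `∇Ψ_{ABCD}` with `z^B z^C z^D` is
`½ ψ ξ_A ξ^C ∇ξ_C`. -/
theorem cov_principal_spinor {q dq : ℕ → ℂ} {G : Fin 2 → Fin 2 → ℂ} {ξ dξ : Fin 2 → ℂ} {ψ : ℂ}
    (hG : G 0 0 + G 1 1 = 0)
    (hq : ∀ A B : Fin 2, q (A + B : ℕ) * ξ 1 ^ 2 - 2 * q (A + B + 1 : ℕ) * ξ 1 * ξ 0
      + q (A + B + 2 : ℕ) * ξ 0 ^ 2 = ψ / 6 * (ξ A * ξ B))
    (hd : ∀ A : Fin 2, dq A * ξ 1 ^ 3 - 3 * dq (A + 1 : ℕ) * ξ 1 ^ 2 * ξ 0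
      + 3 * dq (A + 2 : ℕ) * ξ 1 * ξ 0 ^ 2 - dq (A + 3 : ℕ) * ξ 0 ^ 3
      + 3 * (q A * ξ 1 ^ 2 - 2 * q (A + 1 : ℕ) * ξ 1 * ξ 0 + q (A + 2 : ℕ) * ξ 0 ^ 2) * dξ 1
      - 3 * (q (A + 1 : ℕ) * ξ 1 ^ 2 - 2 * q (A + 2 : ℕ) * ξ 1 * ξ 0
        + q (A + 3 : ℕ) * ξ 0 ^ 2) * dξ 0 = 0) (A : Fin 2) :
    covComp 4 q dq G A * ξ 1 ^ 3 - 3 * covComp 4 q dq G (A + 1 : ℕ) * ξ 1 ^ 2 * ξ 0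
      + 3 * covComp 4 q dq G (A + 2 : ℕ) * ξ 1 * ξ 0 ^ 2 - covComp 4 q dq G (A + 3 : ℕ) * ξ 0 ^ 3 =
    ψ / 2 * ξ A * (ξ 1 * (dξ 0 - ∑ D, G 0 D * ξ D) - ξ 0 * (dξ 1 - ∑ D, G 1 D * ξ D)) := by
  have h11 : G 1 1 = -G 0 0 := by linear_combination hG
  have hF : ∀ C : Fin 2, q C * ξ 1 ^ 3 - 3 * q (C + 1 : ℕ) * ξ 1 ^ 2 * ξ 0
      + 3 * q (C + 2 : ℕ) * ξ 1 * ξ 0 ^ 2 - q (C + 3 : ℕ) * ξ 0 ^ 3 = 0 := by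
    intro C
    -- Contract `hq` once more with `z`; `z` annihilates `ξ`.
    have h0 := hq C 0
    have h1 := hq C 1
    simp at h0 h1
    linear_combination ξ 1 * h0 - ξ 0 * h1
  have hF0 := hF 0
  have hF1 := hF 1
  have h0 := hq A 0
  have h1 := hq A 1
  have hd := hd A
  fin_cases A <;> simp [Fin.sum_univ_two, covComp, h11] at hF0 hF1 h0 h1 hd ⊢
  · linear_combination hd - G 0 0 * hF0 - G 0 1 * hF1
      - 3 * (dξ 1 - (G 1 0 * ξ 0 - G 0 0 * ξ 1)) * h0
      + 3 * (dξ 0 - (G 0 0 * ξ 0 + G 0 1 * ξ 1)) * h1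
  · linear_combination hd - G 1 0 * hF0 + G 0 0 * hF1
      - 3 * (dξ 1 - (G 1 0 * ξ 0 - G 0 0 * ξ 1)) * h0
      + 3 * (dξ 0 - (G 0 0 * ξ 0 + G 0 1 * ξ 1)) * h1

/-- For `ξ = o` or `ξ = ι`, contracting `ψ o_{(A} o_B ι_C ι_{D)}` twice with `ξ^A` leaves
`ψ/6 ξ_A ξ_B`. -/
theorem typeDComp_contract {q : ℕ → ℂ} {ψ : ℂ} {o ι ξ : Fin 2 → ℂ}
    (h : o 0 * ι 1 - o 1 * ι 0 = 1) (hq : ∀ k ≤ 4, q k = typeDComp ψ o ι k) (hξ : ξ = o ∨ ξ = ι)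
    (A B : Fin 2) : q (A + B : ℕ) * ξ 1 ^ 2 - 2 * q (A + B + 1 : ℕ) * ξ 1 * ξ 0
      + q (A + B + 2 : ℕ) * ξ 0 ^ 2 = ψ / 6 * (ξ A * ξ B) := by
  -- Multiplied by `(o_A ι^A)² = 1`, the right-hand side makes the claim a polynomial identity.
  have hL : ∀ L R : ℂ, L = (o 0 * ι 1 - o 1 * ι 0) ^ 2 * R → L = R := fun L R hR => by
    rw [hR, h, one_pow, one_mul]
  rw [hq _ (by omega), hq _ (by omega), hq _ (by omega)]
  apply hL
  rcases hξ with rfl | rfl <;> fin_cases A <;> fin_cases B <;> simp [typeDComp] <;> ring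

/-! ### The normal derivative of a Weyl spinor of type D -/

/-- The components `P_{A BCD} z^B z^C z^D` with `z = ξ^A`, for a symmetric spinor with
components `P`. -/
def cubicContract (P : ℕ → ℂ) (ξ : Fin 2 → ℂ) (A : ℕ) : ℂ :=
  P A * ξ 1 ^ 3 - 3 * P (A + 1) * ξ 1 ^ 2 * ξ 0 + 3 * P (A + 2) * ξ 1 * ξ 0 ^ 2
    - P (A + 3) * ξ 0 ^ 3

theorem binaryForm_raise (P : ℕ → ℂ) (ξ : Fin 2 → ℂ) :
    binaryForm (ofComp P : Spinor 4) (raise ξ) =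
      ξ 1 * cubicContract P ξ 0 - ξ 0 * cubicContract P ξ 1 := by
  rw [binaryForm_ofComp_four, raise_zero, raise_one]
  simp only [cubicContract]
  ring

namespace Tetrad

variable {M : Type*} [TopologicalSpace M] [ChartedSpace (EuclideanSpace ℝ (Fin 4)) M]
  [IsManifold (𝓡 4) ∞ M] {g : LorentzMetric M} (e : Tetrad g)

theorem spinConnectionAlong_trace (x : M) (v : TangentSpace (𝓡 4) x) :
    e.spinConnectionAlong x v 0 0 + e.spinConnectionAlong x v 1 1 = 0 := by
  unfold spinConnectionAlong
  rw [← Finset.sum_add_distrib]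
  refine Finset.sum_eq_zero fun a _ => ?_
  rw [← mul_add, spinConnection_eq, spinConnection_eq]
  simp [Fin.sum_univ_two, eps, twoFormSpinor]

/-- The components of `∇_v Ψ_{ABCD}`. -/
def weylCov (x : M) (v : TangentSpace (𝓡 4) x) : ℕ → ℂ :=
  covComp 4 (fun k => e.weylComp k x) (fun k => mvfderiv (𝓡 4) (e.weylComp k) x v)
    (e.spinConnectionAlong x v)

theorem spinConnectionAlong_add_smul (x : M) (v w : TangentSpace (𝓡 4) x) (c : ℝ) (B C : Fin 2) :
    e.spinConnectionAlong x (v + c • w) B C =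
      e.spinConnectionAlong x v B C + c * e.spinConnectionAlong x w B C := by
  unfold spinConnectionAlong
  rw [Finset.mul_sum, ← Finset.sum_add_distrib]
  refine Finset.sum_congr rfl fun a _ => ?_
  rw [map_add, map_smul, add_apply, smul_apply, smul_eq_mul]
  push_cast
  ring

theorem weylCov_add_smul (x : M) (v w : TangentSpace (𝓡 4) x) (c : ℝ) (k : ℕ) :
    e.weylCov x (v + c • w) k = e.weylCov x v k + c * e.weylCov x w k := by
  simp only [weylCov, covComp, spinConnectionAlong_add_smul, map_add, map_smul, Complex.real_smul]
  ring

theorem weylCov_vec (hvac : e.IsVacuum) (x : M) (a : Fin 4) : ∀ k ≤ 4,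
    e.weylCov x (e.vec a x) k =
      spinorComp (weylMatrix fun b c d f => e.covRiemann a b c d f x) k := by
  refine binaryForm_injective_four fun z => ?_
  rw [← e.covDeriv_weylSpinor_vec hvac x a,
    funext fun y => e.weylSpinor_eq_ofComp hvac y, covDeriv_ofComp]
  rfl

/-- The vacuum Bianchi identity `∇^A_{A'} Ψ_{ABCD} = 0`, contracted with `z^B z^C z^D`. -/
theorem cubicContract_bianchi (hvac : e.IsVacuum) (x : M) (i : Fin 2) (ξ : Fin 2 → ℂ) :
    ∑ b, (ivdw b 1 i * cubicContract (e.weylCov x (e.vec b x)) ξ 0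
      - ivdw b 0 i * cubicContract (e.weylCov x (e.vec b x)) ξ 1) = 0 := by
  have h : ∀ k < 4, ∑ b, (ivdw b 1 i * e.weylCov x (e.vec b x) k
      - ivdw b 0 i * e.weylCov x (e.vec b x) (k + 1)) = 0 := by
    intro k hk
    have h1 := e.weyl_bianchi_comp hvac x i k hk
    rw [← h1, Finset.sum_sub_distrib]
    simp only [e.weylCov_vec hvac x _ k (by omega), e.weylCov_vec hvac x _ (k + 1) (by omega)]
    simp [Fin.sum_univ_two, eps]
    ring
  have h0 := h 0 (by omega)
  have h1 := h 1 (by omega)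
  have h2 := h 2 (by omega)
  have h3 := h 3 (by omega)
  simp only [Fin.sum_univ_four, cubicContract, zero_add] at h0 h1 h2 h3 ⊢
  linear_combination ξ 1 ^ 3 * h0 - 3 * ξ 1 ^ 2 * ξ 0 * h1 + 3 * ξ 1 * ξ 0 ^ 2 * h2 - ξ 0 ^ 3 * h3

/-- The covariant derivative of the cubic covariant, as the variation of the sextic covariant
of the Weyl spinor in the direction `∇_v Ψ`. -/
theorem covDeriv_weylCubic (hvac : e.IsVacuum) (x : M) (v : TangentSpace (𝓡 4) x) :
    e.covDeriv e.weylCubic x v =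
      ofComp (sexticVar (fun k => e.weylComp k x) (e.weylCov x v)) := by
  have h : e.weylCubic = fun y =>
      (ofComp fun k => sexticComp (fun j => e.weylComp j y) k : Spinor 6) := by
    funext y
    rw [weylCubic, e.weylSpinor_eq_ofComp hvac, cubicConcomitant_ofComp]
  have hd : (fun k => mvfderiv (𝓡 4) (fun y => sexticComp (fun j => e.weylComp j y) k) x v) =
      sexticVar (fun k => e.weylComp k x) fun k => mvfderiv (𝓡 4) (e.weylComp k) x v := by
    funext k
    exact (HasDirDeriv.sexticComp (fun j => ⟨(e.hasDirDeriv_weylComp j x v).1, rfl⟩) k).2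
  rw [h, covDeriv_ofComp, hd]
  funext A
  exact covComp_sexticComp _ _ _ (e.spinConnectionAlong_trace x v) _ (sum_val_le A)

end Tetrad

namespace SpacelikeHypersurface

variable {S : Type*} [TopologicalSpace S]
  [ChartedSpace (EuclideanSpace ℝ (Fin 3)) S] [IsManifold (𝓡 3) ∞ S]
  {M : Type*} [TopologicalSpace M] [ChartedSpace (EuclideanSpace ℝ (Fin 4)) M]
  [IsManifold (𝓡 4) ∞ M] {g : LorentzMetric M} (𝒮 : SpacelikeHypersurface S g) (e : Tetrad g)

/-- `N_{00'} N_{11'} - N_{01'} N_{10'} = ½ N_a N^a`. -/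
theorem normalSpinor_det (s : S) :
    𝒮.normalSpinor e s 0 0 * 𝒮.normalSpinor e s 1 1
      - 𝒮.normalSpinor e s 0 1 * 𝒮.normalSpinor e s 1 0 = 1 / 2 := by
  have h := congrArg (g.inner (𝒮.toFun s) (𝒮.normal s))
    (e.sum_eta_inner_smul_vec (𝒮.toFun s) (𝒮.normal s))
  rw [𝒮.normal_unit, map_sum] at h
  simp only [map_smul, smul_eq_mul, Fin.sum_univ_four, eta_zero, eta_one, eta_two, eta_three] at h
  unfold normalSpinor
  simp only [Fin.sum_univ_four, ivdw]
  generalize g.inner (𝒮.toFun s) (𝒮.normal s) (e.vec 0 (𝒮.toFun s)) = n0 at *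
  generalize g.inner (𝒮.toFun s) (𝒮.normal s) (e.vec 1 (𝒮.toFun s)) = n1 at *
  generalize g.inner (𝒮.toFun s) (𝒮.normal s) (e.vec 2 (𝒮.toFun s)) = n2 at *
  generalize g.inner (𝒮.toFun s) (𝒮.normal s) (e.vec 3 (𝒮.toFun s)) = n3 at *
  have hc : (n0 : ℂ) ^ 2 - n1 ^ 2 - n2 ^ 2 - n3 ^ 2 = 1 := by
    have : n0 ^ 2 - n1 ^ 2 - n2 ^ 2 - n3 ^ 2 = 1 := by linear_combination h
    exact_mod_cast this
  have h2 := ofReal_sqrt_two_inv_sq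
  generalize ((Real.sqrt 2 : ℝ) : ℂ)⁻¹ = r at *
  have hI := Complex.I_sq
  simp
  linear_combination (n0 ^ 2 - n1 ^ 2 - n2 ^ 2 - n3 ^ 2 : ℂ) * h2 + hc / 2 + r ^ 2 * n2 ^ 2 * hI

/-- The derivative along `S` of the restriction to `S` of a function on spacetime. -/
theorem hasDirDeriv_comp {f : M → ℂ} {f' : ℂ} (s : S) (u : TangentSpace (𝓡 3) s)
    (hf : HasDirDeriv (mfderiv (𝓡 3) (𝓡 4) 𝒮.toFun s u) f f') :
    HasDirDeriv u (fun r => f (𝒮.toFun r)) f' := by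
  have hS : MDifferentiableAt (𝓡 3) (𝓡 4) 𝒮.toFun s :=
    (𝒮.contMDiff s).mdifferentiableAt (by simp)
  refine ⟨hf.1.comp s hS, ?_⟩
  rw [← hf.2]
  exact mfderiv_comp_apply s hf.1 hS u

theorem hasDirDeriv_eq_zero {f : S → ℂ} {f' : ℂ} {s : S} {u : TangentSpace (𝓡 3) s}
    (hf : HasDirDeriv u f f') (h0 : ∀ᶠ r in nhds s, f r = 0) : f' = 0 := by
  have h1 : mvfderiv (𝓡 3) f s = mvfderiv (𝓡 3) (fun _ : S => (0 : ℂ)) s :=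
    Filter.EventuallyEq.mfderiv_eq h0
  rw [← hf.2, h1, mvfderiv_const]
  rfl

variable {U : Set S} {o ι : S → Fin 2 → ℂ} {ψ : S → ℂ}

theorem IsPetrovAdapted.dyad_det (hD : 𝒮.IsPetrovAdapted e U o ι ψ) {s : S} (hs : s ∈ U) :
    o s 0 * ι s 1 - o s 1 * ι s 0 = 1 := by
  have h := hD.dyad s hs
  rw [Fin.sum_univ_two, raise_zero, raise_one] at h
  linear_combination h

theorem IsPetrovAdapted.weylComp_eq (hvac : e.IsVacuum) (hD : 𝒮.IsPetrovAdapted e U o ι ψ)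
    {s : S} (hs : s ∈ U) :
    ∀ k ≤ 4, e.weylComp k (𝒮.toFun s) = typeDComp (ψ s) (o s) (ι s) k := by
  refine eq_typeDComp fun A => ?_
  rw [← hD.weyl_eq s hs A, e.weylSpinor_eq_ofComp hvac]

/-- Along the hypersurface, the repeated principal spinor `ξ` satisfies
`z^B z^C z^D ∇_u Ψ_{ABCD} = ½ ψ ξ_A ξ^C ∇_u ξ_C`, where `z = ξ^A`. -/
theorem IsPetrovAdapted.cubicContract_tangent (hvac : e.IsVacuum) (hU : IsOpen U)
    (hD : 𝒮.IsPetrovAdapted e U o ι ψ) {ξ : S → Fin 2 → ℂ} (hξ : ξ = o ∨ ξ = ι) {s : S}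
    (hs : s ∈ U) (u : TangentSpace (𝓡 3) s) (A : Fin 2) :
    cubicContract (e.weylCov (𝒮.toFun s) (mfderiv (𝓡 3) (𝓡 4) 𝒮.toFun s u)) (ξ s) A =
      ψ s / 2 * ξ s A * (ξ s 1 * 𝒮.covDerivAlong e ξ s u 0
        - ξ s 0 * 𝒮.covDerivAlong e ξ s u 1) := by
  have hq : ∀ r ∈ U, ∀ A B : Fin 2, e.weylComp (A + B : ℕ) (𝒮.toFun r) * ξ r 1 ^ 2
      - 2 * e.weylComp (A + B + 1 : ℕ) (𝒮.toFun r) * ξ r 1 * ξ r 0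
      + e.weylComp (A + B + 2 : ℕ) (𝒮.toFun r) * ξ r 0 ^ 2 = ψ r / 6 * (ξ r A * ξ r B) :=
    fun r hr => typeDComp_contract (q := fun k => e.weylComp k (𝒮.toFun r)) (hD.dyad_det 𝒮 e hr)
      (hD.weylComp_eq 𝒮 e hvac hr)
      (by rcases hξ with rfl | rfl <;> simp)
  have hsm : ContMDiffAt (𝓡 3) 𝓘(ℝ, Fin 2 → ℂ) ∞ ξ s := by
    rcases hξ with rfl | rfl
    · exact hD.contMDiffOn_o.contMDiffAt (hU.mem_nhds hs)
    · exact hD.contMDiffOn_iota.contMDiffAt (hU.mem_nhds hs)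
  have hdξ : ∀ C, HasDirDeriv u (fun r => ξ r C) (mvfderiv (𝓡 3) (fun r => ξ r C) s u) := fun C =>
    ⟨((contMDiffAt_pi_space.1 hsm) C).mdifferentiableAt (by simp), rfl⟩
  have hdq : ∀ k, HasDirDeriv u (fun r => e.weylComp k (𝒮.toFun r))
      (mvfderiv (𝓡 4) (e.weylComp k) (𝒮.toFun s) (mfderiv (𝓡 3) (𝓡 4) 𝒮.toFun s u)) := fun k =>
    𝒮.hasDirDeriv_comp s u ⟨(e.hasDirDeriv_weylComp k _ (mfderiv (𝓡 3) (𝓡 4) 𝒮.toFun s u)).1, rfl⟩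
  refine cov_principal_spinor (q := fun k => e.weylComp k (𝒮.toFun s)) (ψ := ψ s)
    (dq := fun k =>
      mvfderiv (𝓡 4) (e.weylComp k) (𝒮.toFun s) (mfderiv (𝓡 3) (𝓡 4) 𝒮.toFun s u))
    (G := e.spinConnectionAlong (𝒮.toFun s) (mfderiv (𝓡 3) (𝓡 4) 𝒮.toFun s u))
    (ξ := ξ s) (dξ := fun C => mvfderiv (𝓡 3) (fun r => ξ r C) s u)
    (e.spinConnectionAlong_trace _ _) (hq s hs) (fun B => ?_) A
  have m := fun (c : ℂ) (k : ℕ) (i j l : Fin 2) => (HasDirDeriv.const (v := u) c).mul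
    ((hdq k).mul ((hdξ i).mul ((hdξ j).mul (hdξ l))))
  -- `Ψ_{B...}` contracted with three factors `z` vanishes on `U`, hence so does its derivative.
  have hF := (m 1 B 1 1 1).add ((m (-3) (B + 1) 1 1 0).add ((m 3 (B + 2) 1 0 0).add
    (m (-1) (B + 3) 0 0 0)))
  have hF0 := hasDirDeriv_eq_zero hF (by
    filter_upwards [hU.mem_nhds hs] with r hr
    have h0 := hq r hr B 0
    have h1 := hq r hr B 1
    simp only [Fin.val_zero, Fin.val_one, add_zero, add_assoc] at h0 h1
    norm_num at h0 h1
    linear_combination ξ r 1 * h0 - ξ r 0 * h1)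
  linear_combination hF0

/-- The component of the normal derivative of the Weyl spinor along a principal spinor `ξ`:
`ξ^A ξ^B ξ^C ξ^D 𝒫 Ψ_{ABCD} = -(ψ/√2) ξ^A ξ^B ξ^C 𝒟_{AB} ξ_C`. -/
theorem IsPetrovAdapted.binaryForm_normal (hvac : e.IsVacuum) (hU : IsOpen U)
    (hD : 𝒮.IsPetrovAdapted e U o ι ψ) {ξ : S → Fin 2 → ℂ} (hξ : ξ = o ∨ ξ = ι) {s : S}
    (hs : s ∈ U) :
    binaryForm (ofComp (e.weylCov (𝒮.toFun s) (𝒮.normal s)) : Spinor 4) (raise (ξ s)) =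
      -(ψ s * ((Real.sqrt 2 : ℝ) : ℂ)⁻¹) * ∑ Q, ∑ A, ∑ B,
        raise (ξ s) Q * raise (ξ s) A * raise (ξ s) B * 𝒮.sen e ξ s A B Q := by
  -- `X b` is `ξ^C` times the derivative of `ξ_C` along the tangential part of `e_b`, and `Y` is the
  -- contracted normal derivative of the Weyl spinor.
  set X : Fin 4 → ℂ := fun b =>
    ξ s 1 * 𝒮.covDerivAlong e ξ s (𝒮.tangential s (e.vec b (𝒮.toFun s))) 0
      - ξ s 0 * 𝒮.covDerivAlong e ξ s (𝒮.tangential s (e.vec b (𝒮.toFun s))) 1 with hX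
  set Y := cubicContract (e.weylCov (𝒮.toFun s) (𝒮.normal s)) (ξ s) with hY
  -- Split `e_b` into its tangential and normal parts.
  have hvec : ∀ (b : Fin 4) (A : Fin 2),
      cubicContract (e.weylCov (𝒮.toFun s) (e.vec b (𝒮.toFun s))) (ξ s) A =
        ψ s / 2 * ξ s A * X b
          + (g.inner (𝒮.toFun s) (𝒮.normal s) (e.vec b (𝒮.toFun s)) : ℂ) * Y A := by
    intro b A
    have h1 : e.vec b (𝒮.toFun s) =
        mfderiv (𝓡 3) (𝓡 4) 𝒮.toFun s (𝒮.tangential s (e.vec b (𝒮.toFun s)))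
          + g.inner (𝒮.toFun s) (𝒮.normal s) (e.vec b (𝒮.toFun s)) • 𝒮.normal s := by
      rw [mfderiv_tangential, g.symm _ (𝒮.normal s), sub_add_cancel]
    have h2 := hD.cubicContract_tangent 𝒮 e hvac hU hξ hs
      (𝒮.tangential s (e.vec b (𝒮.toFun s))) A
    rw [hX, ← h2, hY]
    conv_lhs => rw [h1]
    simp only [cubicContract, e.weylCov_add_smul]
    ring
  set m : Fin 2 → ℂ := fun i => ∑ b, (ξ s 1 * ivdw b 0 i - ξ s 0 * ivdw b 1 i) * X b with hm
  have hB : ∀ i, 𝒮.normalSpinor e s 1 i * Y 0 - 𝒮.normalSpinor e s 0 i * Y 1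
      - ψ s / 2 * m i = 0 := by
    intro i
    have h := e.cubicContract_bianchi hvac (𝒮.toFun s) i (ξ s)
    have hv0 := fun b => hvec b 0
    have hv1 := fun b => hvec b 1
    simp only [Fin.val_zero, Fin.val_one] at hv0 hv1
    simp only [hv0, hv1] at h
    clear_value X Y
    rw [← h]
    simp only [normalSpinor, hm, Fin.sum_univ_four]
    ring
  have hsen : ∑ Q, ∑ A, ∑ B,
        raise (ξ s) Q * raise (ξ s) A * raise (ξ s) B * 𝒮.sen e ξ s A B Q =
      ((Real.sqrt 2 : ℝ) : ℂ) *
        ((ξ s 1 * 𝒮.normalSpinor e s 0 1 - ξ s 0 * 𝒮.normalSpinor e s 1 1) * m 0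
        - (ξ s 1 * 𝒮.normalSpinor e s 0 0 - ξ s 0 * 𝒮.normalSpinor e s 1 0) * m 1) := by
    simp only [sen, hm, hX, normalSpinorMixed, Fin.sum_univ_two, Fin.sum_univ_four, raise_zero,
      raise_one]
    simp [eps]
    ring
  rw [hsen, binaryForm_raise]
  have hr : ((Real.sqrt 2 : ℝ) : ℂ)⁻¹ * ((Real.sqrt 2 : ℝ) : ℂ) = 1 :=
    inv_mul_cancel₀ (by simp)
  have hdet := 𝒮.normalSpinor_det e s
  have hB0 := hB 0
  have hB1 := hB 1
  change ξ s 1 * Y 0 - ξ s 0 * Y 1 = _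
  generalize 𝒮.normalSpinor e s = N at *
  clear_value m Y
  linear_combination -2 * (ξ s 1 * N 0 1 - ξ s 0 * N 1 1) * hB0
    + 2 * (ξ s 1 * N 0 0 - ξ s 0 * N 1 0) * hB1
    - 2 * (ξ s 1 * Y 0 - ξ s 0 * Y 1) * hdet
    + ψ s * ((ξ s 1 * N 0 1 - ξ s 0 * N 1 1) * m 0
      - (ξ s 1 * N 0 0 - ξ s 0 * N 1 0) * m 1) * hr

theorem spinCoeff_one_one_zero_one (s : S) : 𝒮.spinCoeff e o ι 1 1 0 1 s =
    ∑ Q, ∑ A, ∑ B, raise (ι s) Q * raise (ι s) A * raise (ι s) B * 𝒮.sen e ι s A B Q := by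
  have hcov : ∀ u C, 𝒮.covDerivAlong e (fun r => -ι r) s u C = -𝒮.covDerivAlong e ι s u C := by
    intro u C
    have h : mvfderiv (𝓡 3) (fun r => (-ι r) C) s u = -mvfderiv (𝓡 3) (fun r => ι r C) s u := by
      change mvfderiv (𝓡 3) (fun r => -ι r C) s u = _
      rw [mvfderiv_fun_neg, neg_apply]
    unfold covDerivAlong
    rw [h]
    simp [Finset.sum_neg_distrib]
    ring
  have hsen : ∀ A B C, 𝒮.sen e (fun r => -ι r) s A B C = -𝒮.sen e ι s A B C := by
    intro A B C
    simp only [sen, hcov, mul_neg, Finset.sum_neg_distrib]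
  change -∑ Q, ∑ A, ∑ B, raise (ι s) Q * raise (ι s) A * raise (ι s) B *
    𝒮.sen e (fun r => -ι r) s A B Q = _
  simp only [hsen, mul_neg, Finset.sum_neg_distrib, neg_neg]

theorem spinCoeff_zero_zero_one_zero (s : S) : 𝒮.spinCoeff e o ι 0 0 1 0 s =
    -∑ Q, ∑ A, ∑ B, raise (o s) Q * raise (o s) A * raise (o s) B * 𝒮.sen e o s A B Q := rfl

theorem IsPetrovAdapted.cubicDot_eq (hvac : e.IsVacuum) (hU : IsOpen U)
    (hD : 𝒮.IsPetrovAdapted e U o ι ψ) {s : S} (hs : s ∈ U) (A : Fin 6 → Fin 2) :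
    𝒮.cubicDot e s A =
      -((Real.sqrt 2 : ℝ) : ℂ) / 8 * ψ s ^ 3 *
        (𝒮.spinCoeff e o ι 1 1 0 1 s * symProd ![o s, o s, o s, o s, o s, ι s] A
          + 𝒮.spinCoeff e o ι 0 0 1 0 s * symProd ![o s, ι s, ι s, ι s, ι s, ι s] A) := by
  have h := e.covDeriv_weylCubic hvac (𝒮.toFun s) (𝒮.normal s)
  rw [funext (sexticVar_congr (hD.weylComp_eq 𝒮 e hvac hs))] at h
  rw [cubicDot, h, sexticVar_typeD _ _ _ (hD.dyad_det 𝒮 e hs),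
    hD.binaryForm_normal 𝒮 e hvac hU (Or.inr rfl) hs,
    hD.binaryForm_normal 𝒮 e hvac hU (Or.inl rfl) hs, ← spinCoeff_one_one_zero_one,
    ← neg_neg (∑ Q, ∑ A, ∑ B, raise (o s) Q * raise (o s) A * raise (o s) B * 𝒮.sen e o s A B Q),
    ← spinCoeff_zero_zero_one_zero]
  have hr : ((Real.sqrt 2 : ℝ) : ℂ)⁻¹ = ((Real.sqrt 2 : ℝ) : ℂ) / 2 := by
    have h0 : ((Real.sqrt 2 : ℝ) : ℂ) ≠ 0 := by simp
    have h2 : ((Real.sqrt 2 : ℝ) : ℂ) ^ 2 = 2 := by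
      rw [← Complex.ofReal_pow, Real.sq_sqrt (by norm_num)]
      norm_num
    field_simp
    exact h2.symm
  rw [hr]
  ring

end SpacelikeHypersurface

/-- The sextic forms `o⁵ι` and `oι⁵` of a spin dyad are linearly independent. -/
theorem symProd_dyad_linearIndependent {o ι : Fin 2 → ℂ} (h : o 0 * ι 1 - o 1 * ι 0 = 1) {a b : ℂ}
    (hab : ∀ A, a * symProd ![o, o, o, o, o, ι] A + b * symProd ![o, ι, ι, ι, ι, ι] A = 0) :
    a = 0 ∧ b = 0 := by
  have hz : ∀ u w : ℂ, a * (u ^ 5 * w) + b * (u * w ^ 5) = 0 := by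
    intro u w
    -- The spinor with `o_A z^A = u` and `ι_A z^A = w`.
    set z : Fin 2 → ℂ := ![u * ι 1 - w * o 1, w * o 0 - u * ι 0] with hzdef
    have ho : ∑ B, o B * z B = u := by
      simp [Fin.sum_univ_two, hzdef]
      linear_combination u * h
    have hi : ∑ B, ι B * z B = w := by
      simp [Fin.sum_univ_two, hzdef]
      linear_combination w * h
    have h1 : a * binaryForm (symProd ![o, o, o, o, o, ι]) z
        + b * binaryForm (symProd ![o, ι, ι, ι, ι, ι]) z = 0 := by
      simp only [binaryForm, Finset.mul_sum, ← Finset.sum_add_distrib]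
      refine Finset.sum_eq_zero fun A _ => ?_
      linear_combination (∏ k, z (A k)) * hab A
    have h5 : ∏ k, ∑ B, (![o, o, o, o, o, ι] : Fin 6 → Fin 2 → ℂ) k B * z B = u ^ 5 * w := by
      rw [Fin.prod_univ_six]
      change (∑ B, o B * z B) * (∑ B, o B * z B) * (∑ B, o B * z B) * (∑ B, o B * z B) *
        (∑ B, o B * z B) * (∑ B, ι B * z B) = _
      rw [ho, hi]
      ring
    have h6 : ∏ k, ∑ B, (![o, ι, ι, ι, ι, ι] : Fin 6 → Fin 2 → ℂ) k B * z B = u * w ^ 5 := by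
      rw [Fin.prod_univ_six]
      change (∑ B, o B * z B) * (∑ B, ι B * z B) * (∑ B, ι B * z B) * (∑ B, ι B * z B) *
        (∑ B, ι B * z B) * (∑ B, ι B * z B) = _
      rw [ho, hi]
      ring
    rwa [binaryForm_symProd, binaryForm_symProd, h5, h6] at h1
  have h1 := hz 1 1
  have h2 := hz 2 1
  constructor
  · linear_combination (h2 - 2 * h1) / 30
  · linear_combination (32 * h1 - h2) / 30

end SpaceSpinor

end

open SpaceSpinor
theorem mainTheorem6
    {M : Type*} [TopologicalSpace M] [ChartedSpace (EuclideanSpace ℝ (Fin 4)) M]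
    [IsManifold (𝓡 4) ∞ M]
    {S : Type*} [TopologicalSpace S] [ChartedSpace (EuclideanSpace ℝ (Fin 3)) S]
    [IsManifold (𝓡 3) ∞ S]
    (g : LorentzMetric M) (e : Tetrad g) (hvac : e.IsVacuum)
    (𝒮 : SpacelikeHypersurface S g)
    (U : Set S) (hU : IsOpen U) (o ι : S → Fin 2 → ℂ) (ψ : S → ℂ)
    (hD : 𝒮.IsPetrovAdapted e U o ι ψ) :
    (∀ s ∈ U, ∀ A : Fin 6 → Fin 2,
      𝒮.cubicDot e s A =
        -((Real.sqrt 2 : ℝ) : ℂ) / 8 * ψ s ^ 3 *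
          (𝒮.spinCoeff e o ι 1 1 0 1 s * symProd ![o s, o s, o s, o s, o s, ι s] A
            + 𝒮.spinCoeff e o ι 0 0 1 0 s * symProd ![o s, ι s, ι s, ι s, ι s, ι s] A)) ∧
    (∀ s ∈ U, 𝒮.cubicDot e s = 0 ↔
      𝒮.spinCoeff e o ι 1 1 0 1 s = 0 ∧ 𝒮.spinCoeff e o ι 0 0 1 0 s = 0) := by
  refine ⟨fun s hs A => hD.cubicDot_eq 𝒮 e hvac hU hs A, fun s hs => ⟨fun h => ?_, fun h => ?_⟩⟩
  · refine symProd_dyad_linearIndependent (hD.dyad_det 𝒮 e hs) fun A => ?_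
    have hA := hD.cubicDot_eq 𝒮 e hvac hU hs A
    rw [h] at hA
    refine (mul_eq_zero.1 hA.symm).resolve_left ?_
    simp [hD.ne_zero s hs]
  · funext A
    rw [hD.cubicDot_eq 𝒮 e hvac hU hs A, h.1, h.2]
    simp
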